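/- **Theorem 4.1.** Let $p\ge 1$. For a unit vector $\theta\in\mathbb R^p$, $r>0$, $v>0$ and $n\ge 1$, let $\mathrm P_{\theta,r,v}=\mathrm P^{(n)}_{\theta,r,v}$ be the joint law of $n$ independent random vectors $X_{n1},\dots,X_{nn}$ that are $p$-variate normal with mean zero and covariance matrix $I_p+rv\,\theta\theta'$. Put $\bar X_n=\frac1n\sum_{i=1}^n X_{ni}$ and $S_n=\frac1n\sum_{i=1}^n(X_{ni}-\bar X_n)(X_{ni}-\bar X_n)'$. Fix a unit $p$-vector $\theta_1^0$, a real $v>0$ and a bounded positive real sequence $(r_n)$, and let $\Sigma_n=I_p+r_nv\,\theta_1^0\theta_1^{0\prime}$. For a positive sequence $(\nu_n)$ call $(\tau_n)$ *admissible* if it is a bounded sequence in $\mathbb R^p$ such that $\theta_1^0+\nu_n\tau_n$ is a unit vector for every $n$, and let $$\Lambda_n=\log\frac{d\mathrm P_{\theta_1^0+\nu_n\tau_n,r_n,v}}{d\mathrm P_{\theta_1^0,r_n,v}} .$$ All stochastic convergences below are as $n\to\infty$ under $\mathrm P_{\theta_1^0,r_n,v}$. - (i) If $r_n\equiv 1$,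 then, with $\nu_n=1/\sqrt n$, $$\Delta_n=\frac{v}{1+v}\sqrt n\,(I_p-\theta_1^0\theta_1^{0\prime})(S_n-\Sigma_n)\theta_1^0,\qquad \Gamma=\frac{v^2}{1+v}(I_p-\theta_1^0\theta_1^{0\prime}),$$ we have, for every admissible $(\tau_n)$, $\Lambda_n=\tau_n'\Delta_n-\frac12\tau_n'\Gamma\tau_n+o_{\mathrm P}(1)$; moreover, $\Delta_n$ is asymptotically normal with mean zero and covariance matrix $\Gamma$. - (ii) If $r_n=o(1)$ with $\sqrt n\,r_n\to\infty$, then, with $\nu_n=1/(\sqrt n\,r_n)$, $$\Delta_n=v\sqrt n\,(I_p-\theta_1^0\theta_1^{0\prime})(S_n-\Sigma_n)\theta_1^0,\qquad \Gamma=v^2(I_p-\theta_1^0\theta_1^{0\prime}),$$ we have, for every admissible $(\tau_n)$, $\Lambda_n=\tau_n'\Delta_n-\frac12\tau_n'\Gamma\tau_n+o_{\mathrm P}(1)$; moreover, $\Delta_n$ is asymptotically normal with mean zero and covariance matrix $\Gamma$. - (iii) If $r_n=1/\sqrt n$ for every $n$, then, with $\nu_n\equiv1$, for every admissible $(\tau_n)$,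 $$\Lambda_n=\tau_n'\Big[v\sqrt n\,(S_n-\Sigma_n)\Big(\theta_1^0+\frac12\tau_n\Big)\Big]-\frac{v^2}{2}\|\tau_n\|^2+\frac{v^2}{8}\|\tau_n\|^4+o_{\mathrm P}(1),$$ where, if $\tau_n\to\tau$, then $\tau_n'\sqrt n\,(S_n-\Sigma_n)(\theta_1^0+\frac12\tau_n)$ is asymptotically normal with mean zero and variance $\|\tau\|^2-\frac14\|\tau\|^4$. - (iv) If $r_n=o(1/\sqrt n)$, then, for every positive sequence $(\nu_n)$, in particular even for $\nu_n\equiv1$, and every admissible $(\tau_n)$, $\Lambda_n=o_{\mathrm P}(1)$. -/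

import Mathlib

open MeasureTheory ProbabilityTheory Filter Topology Matrix
open scoped RealInnerProductSpace Asymptotics

namespace SpikedGaussian

/-- The rank-one matrix `θ θ'`. -/
def outer {p : ℕ} (θ : EuclideanSpace ℝ (Fin p)) : Matrix (Fin p) (Fin p) ℝ :=
  Matrix.vecMulVec θ.ofLp θ.ofLp

/-- The single-spiked covariance matrix `I_p + r v θ θ'`. -/
def spikedCov {p : ℕ} (θ : EuclideanSpace ℝ (Fin p)) (r v : ℝ) : Matrix (Fin p) (Fin p) ℝ :=
  1 + (r * v) • outer θ

/-- The space `(ℝ^p)^n` of samples of size `n`. The coordinates `x i` are the observations. -/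
abbrev Sample (p n : ℕ) : Type := Fin n → EuclideanSpace ℝ (Fin p)

/-- The joint law of `n` independent random vectors, each of them `p`-variate normal with mean zero
and covariance matrix `I_p + r v θ θ'`. -/
noncomputable def sampleLaw {p : ℕ} (n : ℕ) (θ : EuclideanSpace ℝ (Fin p)) (r v : ℝ) :
    Measure (Sample p n) :=
  Measure.pi fun _ : Fin n => multivariateGaussian 0 (spikedCov θ r v)

instance isProbabilityMeasure_sampleLaw {p : ℕ} (n : ℕ) (θ : EuclideanSpace ℝ (Fin p)) (r v : ℝ) :
    IsProbabilityMeasure (sampleLaw n θ r v) := by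
  unfold sampleLaw; infer_instance

/-- The sample mean. -/
noncomputable def sampleMean {p n : ℕ} (x : Sample p n) : EuclideanSpace ℝ (Fin p) :=
  (1 / (n : ℝ)) • ∑ i, x i

/-- The sample covariance matrix, with norming `1 / n`. -/
noncomputable def sampleCov {p n : ℕ} (x : Sample p n) : Matrix (Fin p) (Fin p) ℝ :=
  (1 / (n : ℝ)) • ∑ i, outer (x i - sampleMean x)

/-- `√n (S_n - Σ_n)`, where `Σ_n = I_p + r v θ θ'`. -/
noncomputable def scaledDev {p n : ℕ} (θ : EuclideanSpace ℝ (Fin p)) (r v : ℝ) (x : Sample p n) :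
    Matrix (Fin p) (Fin p) ℝ :=
  √(n : ℝ) • (sampleCov x - spikedCov θ r v)

/-- The local log-likelihood ratio of direction `τ` and size `ν` at `θ`, for samples of size `n`. -/
noncomputable def logLik {p : ℕ} (n : ℕ) (θ : EuclideanSpace ℝ (Fin p)) (r v ν : ℝ)
    (τ : EuclideanSpace ℝ (Fin p)) : Sample p n → ℝ :=
  llr (sampleLaw n (θ + ν • τ) r v) (sampleLaw n θ r v)

/-- `(τ_n)` is bounded and, for every sample size `n ≥ 1`, `θ + ν_n τ_n` is a unit vector. -/
def IsAdmissible {p : ℕ} (θ : EuclideanSpace ℝ (Fin p)) (ν : ℕ → ℝ)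
    (τ : ℕ → EuclideanSpace ℝ (Fin p)) : Prop :=
  (∃ B : ℝ, ∀ n, 1 ≤ n → ‖τ n‖ ≤ B) ∧ ∀ n, 1 ≤ n → ‖θ + ν n • τ n‖ = 1

/-- `Y_n = o_P(1)` as `n → ∞`, where `Y_n` is defined on a probability space `(Ω_n, P_n)`. -/
def IsLittleOP {Ω : ℕ → Type*} [∀ n, MeasurableSpace (Ω n)] (P : ∀ n, Measure (Ω n))
    (Y : ∀ n, Ω n → ℝ) : Prop :=
  ∀ ε : ℝ, 0 < ε → Tendsto (fun n => P n {ω | ε ≤ |Y n ω|}) atTop (𝓝 0)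

end SpikedGaussian

open SpikedGaussian

/-! Changing the direction of the spike leaves the determinant of the covariance unchanged, so the
log-likelihood ratio is exactly a quadratic form in the data (`llr_sampleLaw`). With `δ = ν τ` a
chord of the unit sphere, `⟪θ + δ, x⟫² - ⟪θ, x⟫² = 2 ⟪δ, x⟫ ⟪θ + δ/2, x⟫`, and `δ` is orthogonal to
`θ + δ/2`. Centring gives an identity without Taylor remainder (`logRatio_eq`): a coefficient times
the form of `√n (S_n - Σ_n)` at `δ` and `θ + δ/2`, plus the contribution of the sample mean, minus a
constant.

The limits of `√n r ν` and `r` then determine the limiting coefficients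
(`tendsto_spike_coefficients`). All errors are controlled in mean absolute value: the covariance
form is `O(‖a‖ ‖b‖)` and the mean form is smaller by `√n` (`exists_meanAbsLE_forms`).

For the limit laws, the sample is written as the image of a standard Gaussian one under a square
root of the covariance. That map is self-adjoint, so the spike moves to the test vectors. For
orthogonal limiting vectors the central limit theorem applies to products of two independent
Gaussian variables (`tendsto_integral_cexp_devForm`). -/

namespace SpikedGaussian

/-! ### Square root of a spiked covariance matrix. -/

section SpikeMap

variable {E : Type*} [NormedAddCommGroup E] [InnerProductSpace ℝ E]

/-- The self-adjoint map that multiplies the direction of the unit vector `θ` by `s` and fixes its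
orthogonal complement. -/
noncomputable def spikeMap (θ : E) (s : ℝ) : E →L[ℝ] E :=
  ContinuousLinearMap.id ℝ E + (s - 1) • (innerSL ℝ θ).smulRight θ

lemma spikeMap_apply (θ : E) (s : ℝ) (z : E) : spikeMap θ s z = z + ((s - 1) * ⟪θ, z⟫) • θ := by
  simp [spikeMap, smul_smul]

lemma inner_spikeMap_right (θ : E) (s : ℝ) (a z : E) :
    ⟪a, spikeMap θ s z⟫ = ⟪spikeMap θ s a, z⟫ := by
  simp only [spikeMap_apply, inner_add_left, inner_add_right, inner_smul_left, inner_smul_right,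
    real_inner_comm a θ, conj_trivial]
  ring

lemma inner_spikeMap_spikeMap {θ : E} (hθ : ‖θ‖ = 1) (s : ℝ) (a b : E) :
    ⟪spikeMap θ s a, spikeMap θ s b⟫ = ⟪a, b⟫ + (s ^ 2 - 1) * (⟪θ, a⟫ * ⟪θ, b⟫) := by
  have h : ⟪θ, θ⟫ = (1 : ℝ) := by rw [real_inner_self_eq_norm_sq, hθ]; norm_num
  simp only [spikeMap_apply, inner_add_left, inner_add_right, inner_smul_left, inner_smul_right,
    real_inner_comm a θ, h, conj_trivial]
  ring

end SpikeMap

/-! ### Density of one spiked observation with respect to the standard Gaussian law. -/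

section Gaussian

/-- The density of the centred normal law of variance `1 + u` with respect to the standard one. -/
noncomputable def varianceDensity (u x : ℝ) : ℝ :=
  (√(1 + u))⁻¹ * Real.exp (u / (1 + u) / 2 * x ^ 2)

lemma varianceDensity_pos {u : ℝ} (hu : 0 < u) (x : ℝ) : 0 < varianceDensity u x := by
  unfold varianceDensity; positivity

lemma measurable_varianceDensity (u : ℝ) : Measurable (varianceDensity u) := by
  unfold varianceDensity; fun_prop

lemma gaussianReal_eq_withDensity {u : ℝ} (hu : 0 < u) :
    gaussianReal 0 (1 + u).toNNReal =
      (gaussianReal 0 1).withDensity fun x => ENNReal.ofReal (varianceDensity u x) := by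
  have h1 : (1 + u).toNNReal ≠ 0 := by simp; linarith
  rw [gaussianReal_of_var_ne_zero 0 h1, gaussianReal_of_var_ne_zero 0 one_ne_zero,
    ← withDensity_mul _ (measurable_gaussianPDF 0 1)
      (measurable_varianceDensity u).ennreal_ofReal]
  congr 1
  ext x
  simp only [Pi.mul_apply, gaussianPDF]
  rw [← ENNReal.ofReal_mul (gaussianPDFReal_nonneg _ _ _)]
  congr 1
  simp only [gaussianPDFReal, varianceDensity, NNReal.coe_one,
    Real.coe_toNNReal _ (by linarith : 0 ≤ 1 + u)]
  have h2 : (0 : ℝ) < 1 + u := by linarith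
  rw [mul_one, Real.sqrt_mul (by positivity), mul_inv,
    show ∀ a b c d : ℝ, a * b * (c * d) = a * c * (b * d) by intros; ring, ← Real.exp_add]
  congr 2
  field_simp
  ring

variable {E : Type*} [NormedAddCommGroup E] [InnerProductSpace ℝ E] [FiniteDimensional ℝ E]
  [MeasurableSpace E] [BorelSpace E]

lemma integral_inner_stdGaussian (a : E) : ∫ z, ⟪a, z⟫ ∂(stdGaussian E) = 0 :=
  integral_strongDual_stdGaussian (innerSL ℝ a)

lemma memLp_inner_stdGaussian (a : E) (q : ENNReal) (hq : q ≠ ⊤) :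
    MemLp (fun z => ⟪a, z⟫) q (stdGaussian E) :=
  (IsGaussian.memLp_id (stdGaussian E) q hq).const_inner a

lemma covariance_inner_stdGaussian (a b : E) :
    cov[fun z => ⟪a, z⟫, fun z => ⟪b, z⟫; stdGaussian E] = ⟪a, b⟫ := by
  rw [← covarianceBilin_apply_eq_cov IsGaussian.memLp_two_id, covarianceBilin_stdGaussian]
  rfl

lemma integral_inner_mul_inner_stdGaussian (a b : E) :
    ∫ z, ⟪a, z⟫ * ⟪b, z⟫ ∂(stdGaussian E) = ⟪a, b⟫ := by
  rw [← covariance_inner_stdGaussian, covariance_eq_sub (memLp_inner_stdGaussian _ _ (by simp))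
    (memLp_inner_stdGaussian _ _ (by simp)), integral_inner_stdGaussian]
  simp

lemma map_inner_stdGaussian (a : E) :
    (stdGaussian E).map (fun z => ⟪a, z⟫) = gaussianReal 0 (‖a‖ ^ 2).toNNReal := by
  have h := IsGaussian.map_eq_gaussianReal (μ := stdGaussian E) (innerSL ℝ a)
  rw [integral_strongDual_stdGaussian, variance_dual_stdGaussian, innerSL_apply_norm] at h
  exact h

lemma indepFun_inner_stdGaussian {a b : E} (hab : ⟪a, b⟫ = 0) :
    IndepFun (fun z => ⟪a, z⟫) (fun z => ⟪b, z⟫) (stdGaussian E) := by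
  apply HasGaussianLaw.indepFun_of_covariance_eq_zero
  · exact (IsGaussian.hasGaussianLaw_id (μ := stdGaussian E)).map_fun
      ((innerSL ℝ a).prod (innerSL ℝ b))
  · rw [covariance_inner_stdGaussian, hab]

lemma charFun_map_spikeMap {θ : E} (hθ : ‖θ‖ = 1) {u : ℝ} (hu : 0 < u) (t : E) :
    charFun ((stdGaussian E).map (spikeMap θ √(1 + u))) t =
      Complex.exp ((-(‖t‖ ^ 2 + u * ⟪θ, t⟫ ^ 2) / 2 : ℝ)) := by
  rw [charFun_apply, integral_map (by fun_prop) (by fun_prop)]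
  have : ∀ x : E, ⟪spikeMap θ √(1 + u) x, t⟫ = ⟪x, spikeMap θ √(1 + u) t⟫ := fun x => by
    rw [inner_spikeMap_right]
  simp_rw [this]
  rw [← charFun_apply, charFun_stdGaussian]
  congr 1
  have h := inner_spikeMap_spikeMap hθ √(1 + u) t t
  rw [real_inner_self_eq_norm_sq, real_inner_self_eq_norm_sq, Real.sq_sqrt (by linarith)] at h
  rw [← Complex.ofReal_pow, h]
  push_cast
  ring

/-- The characteristic functions agree. Split `t` into its component along `θ` and a remainder `w`
orthogonal to `θ`. The forms `⟪θ, x⟫` and `⟪w, x⟫` are independent, so the integral factors, and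
only the first factor sees the density, which turns variance `1` into `1 + u`. -/
lemma map_spikeMap_eq_withDensity {θ : E} (hθ : ‖θ‖ = 1) {u : ℝ} (hu : 0 < u) :
    (stdGaussian E).map (spikeMap θ √(1 + u)) =
      (stdGaussian E).withDensity fun x => ENNReal.ofReal (varianceDensity u ⟪θ, x⟫) := by
  have hm : Measurable fun x : E => ENNReal.ofReal (varianceDensity u ⟪θ, x⟫) :=
    ((measurable_varianceDensity u).comp (by fun_prop)).ennreal_ofReal
  have hmd : Measurable fun x : ℝ => ENNReal.ofReal (varianceDensity u x) :=
    (measurable_varianceDensity u).ennreal_ofReal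
  have hlaw : (stdGaussian E).map (fun z => ⟪θ, z⟫) = gaussianReal 0 1 := by
    rw [map_inner_stdGaussian, hθ]; simp
  -- Characteristic functions separate finite measures only; the total mass is computed on the
  -- marginal along `θ`.
  have hfin : IsFiniteMeasure ((stdGaussian E).withDensity fun x =>
      ENNReal.ofReal (varianceDensity u ⟪θ, x⟫)) := by
    apply isFiniteMeasure_withDensity
    rw [← lintegral_map (f := fun x => ENNReal.ofReal (varianceDensity u x))
      (g := fun z => ⟪θ, z⟫) hmd (by fun_prop), hlaw, ← setLIntegral_univ,
      ← withDensity_apply _ MeasurableSet.univ, ← gaussianReal_eq_withDensity hu]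
    simp
  have : IsProbabilityMeasure ((stdGaussian E).map (spikeMap θ √(1 + u))) :=
    Measure.isProbabilityMeasure_map (by fun_prop)
  refine Measure.ext_of_charFun ?_
  ext t
  rw [charFun_map_spikeMap hθ hu, charFun_apply,
    integral_withDensity_eq_integral_toReal_smul hm (by simp)]
  set w : E := t - ⟪θ, t⟫ • θ with hw
  have hθθ : ⟪θ, θ⟫ = (1 : ℝ) := by rw [real_inner_self_eq_norm_sq, hθ]; norm_num
  have hθw : ⟪θ, w⟫ = 0 := by
    rw [hw, inner_sub_right, inner_smul_right, hθθ]; ring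
  have hww : ‖w‖ ^ 2 = ‖t‖ ^ 2 - ⟪θ, t⟫ ^ 2 := by
    rw [← real_inner_self_eq_norm_sq, ← real_inner_self_eq_norm_sq, hw]
    simp only [inner_sub_left, inner_sub_right, inner_smul_left, inner_smul_right, hθθ,
      real_inner_comm t θ, conj_trivial]
    ring
  have hsplit : ∀ x : E, (ENNReal.ofReal (varianceDensity u ⟪θ, x⟫)).toReal •
      Complex.exp (⟪x, t⟫ * Complex.I) =
      ((varianceDensity u ⟪θ, x⟫ : ℂ) * Complex.exp (⟪θ, x⟫ * ⟪θ, t⟫ * Complex.I)) *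
        Complex.exp (⟪w, x⟫ * Complex.I) := fun x => by
    rw [ENNReal.toReal_ofReal (varianceDensity_pos hu _).le, Complex.real_smul, mul_assoc,
      ← Complex.exp_add]
    congr 2
    rw [← add_mul]
    congr 1
    norm_cast
    simp only [hw, inner_sub_left, inner_smul_left, conj_trivial, real_inner_comm x t]
    ring
  simp_rw [hsplit]
  rw [(indepFun_inner_stdGaussian hθw).integral_fun_comp_mul_comp
    (f := fun y : ℝ => (varianceDensity u y : ℂ) * Complex.exp (y * ⟪θ, t⟫ * Complex.I))
    (g := fun y : ℝ => Complex.exp (y * Complex.I)) (by fun_prop) (by fun_prop)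
    (by have := measurable_varianceDensity u
        exact Measurable.aestronglyMeasurable (by fun_prop))
    (Measurable.aestronglyMeasurable (by fun_prop))]
  have h1 : ∫ x, (varianceDensity u ⟪θ, x⟫ : ℂ) * Complex.exp (⟪θ, x⟫ * ⟪θ, t⟫ * Complex.I)
      ∂(stdGaussian E) = Complex.exp (-((1 + u) * ⟪θ, t⟫ ^ 2) / 2 : ℝ) := by
    rw [← integral_map (φ := fun z => ⟪θ, z⟫)
      (f := fun y : ℝ => (varianceDensity u y : ℂ) * Complex.exp (y * ⟪θ, t⟫ * Complex.I))
      (by fun_prop) (by have := measurable_varianceDensity u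
                        exact Measurable.aestronglyMeasurable (by fun_prop)), hlaw]
    have h := charFun_gaussianReal (μ := 0) (v := (1 + u).toNNReal) ⟪θ, t⟫
    rw [gaussianReal_eq_withDensity hu, charFun_apply_real,
      integral_withDensity_eq_integral_toReal_smul hmd (by simp)] at h
    rw [Real.coe_toNNReal _ (by linarith)] at h
    calc _ = _ := integral_congr_ae (ae_of_all _ fun y => by
          simp only [ENNReal.toReal_ofReal (varianceDensity_pos hu _).le, Complex.real_smul]
          rw [mul_comm (y : ℂ)])
      _ = _ := h
      _ = _ := by congr 1; push_cast; ring
  have h2 : ∫ x, Complex.exp (⟪w, x⟫ * Complex.I) ∂(stdGaussian E) =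
      Complex.exp (-(‖t‖ ^ 2 - ⟪θ, t⟫ ^ 2) / 2 : ℝ) := by
    have h := charFun_stdGaussian w
    rw [charFun_apply] at h
    simp_rw [real_inner_comm w] at h
    rw [h, ← hww]
    congr 1
    push_cast
    ring
  rw [h1, h2, ← Complex.exp_add]
  congr 1
  push_cast
  ring

end Gaussian

/-- It suffices to compare on boxes, where the indicator is also a product over coordinates and
independence factors the integral. -/
lemma pi_withDensity {ι : Type*} [Fintype ι] {α : Type*} [MeasurableSpace α] (μ : Measure α)
    [IsProbabilityMeasure μ] {f : α → ENNReal} (hf : Measurable f)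
    [SigmaFinite (μ.withDensity f)] :
    Measure.pi (fun _ : ι => μ.withDensity f) =
      (Measure.pi fun _ : ι => μ).withDensity fun x => ∏ i, f (x i) := by
  refine Measure.pi_eq fun s hs => ?_
  rw [withDensity_apply _ (MeasurableSet.univ_pi hs), ← lintegral_indicator (MeasurableSet.univ_pi hs)]
  have h : ∀ x : ι → α, (Set.univ.pi s).indicator (fun x => ∏ i, f (x i)) x =
      ∏ i, (s i).indicator f (x i) := fun x => by
    by_cases hx : x ∈ Set.univ.pi s
    · rw [Set.indicator_of_mem hx]
      exact Finset.prod_congr rfl fun i _ => (Set.indicator_of_mem (hx i trivial) f).symm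
    · rw [Set.indicator_of_notMem hx]
      simp only [Set.mem_pi, Set.mem_univ, true_imp_iff, not_forall] at hx
      obtain ⟨i, hi⟩ := hx
      exact (Finset.prod_eq_zero (Finset.mem_univ i) (Set.indicator_of_notMem hi f)).symm
  simp_rw [h]
  have hm : ∀ i, Measurable ((s i).indicator f) := fun i => hf.indicator (hs i)
  rw [lintegral_prod_eq_prod_lintegral_of_indepFun Finset.univ
    (fun i (x : ι → α) => (s i).indicator f (x i))
    (iIndepFun_pi (X := fun i => (s i).indicator f) fun i => (hm i).aemeasurable)
    fun i => (hm i).comp (measurable_pi_apply i)]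
  refine Finset.prod_congr rfl fun i _ => ?_
  rw [withDensity_apply _ (hs i), ← lintegral_indicator (hs i),
    ← (measurePreserving_eval (fun _ : ι => μ) i).lintegral_comp (hm i)]

/-! ### The sample law and its exact log-likelihood ratio. -/

section Sample

variable {p : ℕ}

lemma dotProduct_eq_inner (a b : EuclideanSpace ℝ (Fin p)) : a.ofLp ⬝ᵥ b.ofLp = ⟪a, b⟫ := by
  rw [PiLp.inner_apply]
  simp [dotProduct, mul_comm]

lemma dotProduct_outer_mulVec (θ a b : EuclideanSpace ℝ (Fin p)) :
    a.ofLp ⬝ᵥ outer θ *ᵥ b.ofLp = ⟪θ, a⟫ * ⟪θ, b⟫ := by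
  rw [outer, Matrix.vecMulVec_mulVec, dotProduct_smul, dotProduct_eq_inner, dotProduct_eq_inner,
    real_inner_comm a θ]
  simp [mul_comm]

lemma posSemidef_outer (θ : EuclideanSpace ℝ (Fin p)) : (outer θ).PosSemidef := by
  simpa [outer] using Matrix.posSemidef_vecMulVec_self_star θ.ofLp

lemma posSemidef_spikedCov (θ : EuclideanSpace ℝ (Fin p)) {r v : ℝ} (h : 0 ≤ r * v) :
    (spikedCov θ r v).PosSemidef :=
  Matrix.PosSemidef.one.add ((posSemidef_outer θ).smul h)

lemma multivariateGaussian_spikedCov {θ : EuclideanSpace ℝ (Fin p)} (hθ : ‖θ‖ = 1) {r v : ℝ}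
    (hr : 0 < r) (hv : 0 < v) :
    multivariateGaussian 0 (spikedCov θ r v) =
      (stdGaussian (EuclideanSpace ℝ (Fin p))).map (spikeMap θ √(1 + r * v)) := by
  have : IsProbabilityMeasure ((stdGaussian (EuclideanSpace ℝ (Fin p))).map
      (spikeMap θ √(1 + r * v))) := Measure.isProbabilityMeasure_map (by fun_prop)
  refine Measure.ext_of_charFun ?_
  ext t
  rw [charFun_map_spikeMap hθ (by positivity),
    charFun_multivariateGaussian (posSemidef_spikedCov θ (by positivity)), spikedCov,
    Matrix.add_mulVec, Matrix.smul_mulVec, dotProduct_add, dotProduct_smul,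
    dotProduct_outer_mulVec, Matrix.one_mulVec, dotProduct_eq_inner, real_inner_self_eq_norm_sq]
  congr 1
  simp
  ring

/-- The quadratic form of the log-likelihood ratio between two directions of the spike. -/
noncomputable def logRatio (u : ℝ) {n : ℕ} (θ η : EuclideanSpace ℝ (Fin p)) (x : Sample p n) : ℝ :=
  u / (1 + u) / 2 * ∑ i, (⟪η, x i⟫ ^ 2 - ⟪θ, x i⟫ ^ 2)

/-- Reduces expectations under laws that vary with the spike to expectations under standard Gaussian
samples. -/
lemma sampleLaw_eq_map (n : ℕ) {θ : EuclideanSpace ℝ (Fin p)} (hθ : ‖θ‖ = 1) {r v : ℝ}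
    (hr : 0 < r) (hv : 0 < v) :
    sampleLaw n θ r v = (Measure.pi fun _ : Fin n => stdGaussian (EuclideanSpace ℝ (Fin p))).map
      fun z i => spikeMap θ √(1 + r * v) (z i) := by
  have : IsProbabilityMeasure ((stdGaussian (EuclideanSpace ℝ (Fin p))).map
      (spikeMap θ √(1 + r * v))) := Measure.isProbabilityMeasure_map (by fun_prop)
  rw [Measure.pi_map_pi (fun _ => by fun_prop), sampleLaw, multivariateGaussian_spikedCov hθ hr hv]

/-- The normalising factor `(√(1 + u))⁻¹` does not depend on the direction, so it cancels in the
quotient of the two densities and only the exponentials remain. -/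
lemma llr_sampleLaw (n : ℕ) {θ η : EuclideanSpace ℝ (Fin p)} (hθ : ‖θ‖ = 1) (hη : ‖η‖ = 1)
    {r v : ℝ} (hr : 0 < r) (hv : 0 < v) :
    llr (sampleLaw n η r v) (sampleLaw n θ r v) =ᵐ[sampleLaw n θ r v] logRatio (r * v) θ η := by
  have hu : 0 < r * v := by positivity
  set u := r * v
  have hD : ∀ ζ : EuclideanSpace ℝ (Fin p), Measurable fun x : EuclideanSpace ℝ (Fin p) =>
      ENNReal.ofReal (varianceDensity u ⟪ζ, x⟫) := fun ζ =>
    ((measurable_varianceDensity u).comp (by fun_prop)).ennreal_ofReal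
  set f : EuclideanSpace ℝ (Fin p) → ENNReal := fun x =>
    ENNReal.ofReal (Real.exp (u / (1 + u) / 2 * (⟪η, x⟫ ^ 2 - ⟪θ, x⟫ ^ 2)))
  have hf : Measurable f := by fun_prop
  have hone : multivariateGaussian 0 (spikedCov η r v) =
      (multivariateGaussian 0 (spikedCov θ r v)).withDensity f := by
    rw [multivariateGaussian_spikedCov hη hr hv, multivariateGaussian_spikedCov hθ hr hv,
      map_spikeMap_eq_withDensity hη hu, map_spikeMap_eq_withDensity hθ hu,
      ← withDensity_mul _ (hD θ) hf]
    congr 1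
    ext x
    simp only [Pi.mul_apply, f]
    rw [← ENNReal.ofReal_mul (varianceDensity_pos hu _).le]
    simp only [varianceDensity]
    rw [mul_assoc, ← Real.exp_add]
    ring_nf
  have hsig : IsProbabilityMeasure ((multivariateGaussian 0 (spikedCov θ r v)).withDensity f) := by
    rw [← hone]; infer_instance
  have hall : sampleLaw n η r v = (sampleLaw n θ r v).withDensity fun x => ∏ i, f (x i) := by
    rw [sampleLaw, sampleLaw, hone, pi_withDensity _ hf]
  rw [hall]
  have hF : Measurable fun x : Sample p n => ∏ i, f (x i) :=
    Finset.measurable_prod _ fun i _ => hf.comp (measurable_pi_apply i)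
  filter_upwards [Measure.rnDeriv_withDensity (sampleLaw n θ r v) hF] with x hx
  rw [llr, hx]
  simp only [f]
  rw [← ENNReal.ofReal_prod_of_nonneg fun i _ => (Real.exp_pos _).le, ← Real.exp_sum,
    ENNReal.toReal_ofReal (Real.exp_pos _).le, Real.log_exp, logRatio, Finset.mul_sum]

end Sample

/-! ### Stochastic smallness through first absolute moments. -/

section MeanAbsolute

variable {Ω : Type*} [MeasurableSpace Ω] {P : Measure Ω}

/-- `Y` is integrable with mean absolute value at most `c`. -/
def MeanAbsLE (P : Measure Ω) (Y : Ω → ℝ) (c : ℝ) : Prop :=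
  Integrable Y P ∧ ∫ ω, |Y ω| ∂P ≤ c

lemma MeanAbsLE.add {Y Z : Ω → ℝ} {c d : ℝ} (hY : MeanAbsLE P Y c) (hZ : MeanAbsLE P Z d) :
    MeanAbsLE P (fun ω => Y ω + Z ω) (c + d) := by
  refine ⟨hY.1.add hZ.1, ?_⟩
  calc ∫ ω, |Y ω + Z ω| ∂P ≤ ∫ ω, (|Y ω| + |Z ω|) ∂P :=
        integral_mono (hY.1.add hZ.1).abs (hY.1.abs.add hZ.1.abs) fun ω => abs_add_le _ _
    _ = ∫ ω, |Y ω| ∂P + ∫ ω, |Z ω| ∂P := integral_add hY.1.abs hZ.1.abs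
    _ ≤ c + d := add_le_add hY.2 hZ.2

lemma MeanAbsLE.const_mul {Y : Ω → ℝ} {c : ℝ} (hY : MeanAbsLE P Y c) (k : ℝ) :
    MeanAbsLE P (fun ω => k * Y ω) (|k| * c) := by
  refine ⟨hY.1.const_mul k, ?_⟩
  simp_rw [abs_mul]
  rw [integral_const_mul]
  exact mul_le_mul_of_nonneg_left hY.2 (abs_nonneg k)

lemma MeanAbsLE.sub {Y Z : Ω → ℝ} {c d : ℝ} (hY : MeanAbsLE P Y c) (hZ : MeanAbsLE P Z d) :
    MeanAbsLE P (fun ω => Y ω - Z ω) (c + d) := by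
  have h := hY.add (hZ.const_mul (-1))
  simpa [sub_eq_add_neg] using h

lemma meanAbsLE_const [IsProbabilityMeasure P] (k : ℝ) : MeanAbsLE P (fun _ => k) |k| :=
  ⟨integrable_const k, by simp⟩

lemma MeanAbsLE.mono {Y : Ω → ℝ} {c d : ℝ} (hY : MeanAbsLE P Y c) (h : c ≤ d) :
    MeanAbsLE P Y d := ⟨hY.1, hY.2.trans h⟩

/-- The variance of `|Y|` is nonnegative. -/
lemma MeanAbsLE.of_sq [IsProbabilityMeasure P] {Y : Ω → ℝ} {c : ℝ} (hY : MemLp Y 2 P)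
    (hc : 0 ≤ c) (h : ∫ ω, Y ω ^ 2 ∂P ≤ c ^ 2) : MeanAbsLE P Y c := by
  refine ⟨hY.integrable (by norm_num), ?_⟩
  have h1 := variance_nonneg |Y| P
  rw [variance_eq_sub hY.abs] at h1
  simp only [Pi.pow_apply, Pi.abs_apply, sq_abs] at h1
  exact abs_le_of_sq_le_sq' (by linarith) hc |>.2

lemma MeanAbsLE.map {Ω' : Type*} [MeasurableSpace Ω'] {f : Ω → Ω'} (hf : Measurable f)
    {Y : Ω' → ℝ} (hYm : Measurable Y) {c : ℝ} (hY : MeanAbsLE P (fun ω => Y (f ω)) c) :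
    MeanAbsLE (P.map f) Y c := by
  refine ⟨(integrable_map_measure hYm.aestronglyMeasurable hf.aemeasurable).2 hY.1, ?_⟩
  rw [integral_map hf.aemeasurable hYm.abs.aestronglyMeasurable]
  exact hY.2

/-- Markov's inequality. The almost everywhere equality accommodates log-likelihood ratios, whose
explicit formula holds only almost everywhere. -/
lemma isLittleOP_of_meanAbsLE {Ω : ℕ → Type*} [∀ n, MeasurableSpace (Ω n)]
    {P : ∀ n, Measure (Ω n)} [∀ n, IsProbabilityMeasure (P n)] {Y Z : ∀ n, Ω n → ℝ} {c : ℕ → ℝ}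
    (hYZ : ∀ᶠ n in atTop, Y n =ᵐ[P n] Z n) (hZ : ∀ᶠ n in atTop, MeanAbsLE (P n) (Z n) (c n))
    (hc : Tendsto c atTop (𝓝 0)) : IsLittleOP P Y := by
  intro ε hε
  have hlim : Tendsto (fun n => ENNReal.ofReal (c n / ε)) atTop (𝓝 0) := by
    have := ENNReal.tendsto_ofReal (hc.div_const ε)
    simpa using this
  refine tendsto_of_tendsto_of_tendsto_of_le_of_le' tendsto_const_nhds hlim
    (Eventually.of_forall fun _ => zero_le) ?_
  filter_upwards [hYZ, hZ] with n h1 h2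
  have h3 : P n {ω | ε ≤ |Y n ω|} = P n {ω | ε ≤ |Z n ω|} := by
    apply measure_congr
    filter_upwards [h1] with ω hω
    change (ε ≤ |Y n ω|) = (ε ≤ |Z n ω|)
    rw [hω]
  rw [h3, ← ENNReal.ofReal_toReal (measure_ne_top (P n) {ω | ε ≤ |Z n ω|})]
  apply ENNReal.ofReal_le_ofReal
  rw [le_div_iff₀ hε, mul_comm]
  exact (mul_meas_ge_le_integral_of_nonneg (ae_of_all _ fun ω => abs_nonneg (Z n ω)) h2.1.abs ε).trans
    h2.2

/-- The map `y ↦ exp (i y)` is 1-Lipschitz. This plays the role of Slutsky's lemma in the limit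
theorems. -/
lemma norm_integral_cexp_sub_le [IsProbabilityMeasure P] {Y Z : Ω → ℝ} (hY : Measurable Y)
    (hZ : Measurable Z) {c : ℝ} (h : MeanAbsLE P (fun ω => Y ω - Z ω) c) :
    ‖∫ ω, Complex.exp (Y ω * Complex.I) ∂P - ∫ ω, Complex.exp (Z ω * Complex.I) ∂P‖ ≤ c := by
  have hint : ∀ X : Ω → ℝ, Measurable X → Integrable (fun ω => Complex.exp (X ω * Complex.I)) P :=
    fun X hX => Integrable.of_bound (Measurable.aestronglyMeasurable (by fun_prop)) 1
      (ae_of_all _ fun ω => by rw [Complex.norm_exp_ofReal_mul_I])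
  rw [← integral_sub (hint Y hY) (hint Z hZ)]
  refine (norm_integral_le_integral_norm _).trans (le_trans ?_ h.2)
  refine integral_mono ((hint Y hY).sub (hint Z hZ)).norm h.1.abs fun ω => ?_
  have h1 : Complex.exp (Y ω * Complex.I) - Complex.exp (Z ω * Complex.I) =
      Complex.exp (Z ω * Complex.I) * (Complex.exp (Complex.I * ((Y ω - Z ω : ℝ) : ℂ)) - 1) := by
    rw [mul_sub, ← Complex.exp_add]
    push_cast
    ring_nf
  simp only []
  rw [h1, norm_mul, Complex.norm_exp_ofReal_mul_I, one_mul]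
  exact Real.norm_exp_I_mul_ofReal_sub_one_le

end MeanAbsolute

/-! ### Second moments of sums of independent copies. -/

section Product

variable {α : Type*} [MeasurableSpace α] {μ : Measure α} [IsProbabilityMeasure μ] {n : ℕ}

lemma memLp_two_sum_pi {X : α → ℝ} (hX : MemLp X 2 μ) :
    MemLp (fun z : Fin n → α => ∑ i, X (z i)) 2 (Measure.pi fun _ => μ) :=
  memLp_finsetSum _ fun i _ =>
    hX.comp_measurePreserving (measurePreserving_eval (fun _ : Fin n => μ) i)

lemma integral_sq_sum_pi {X : α → ℝ} (hX : MemLp X 2 μ) (h0 : ∫ x, X x ∂μ = 0) :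
    ∫ z : Fin n → α, (∑ i, X (z i)) ^ 2 ∂(Measure.pi fun _ => μ) = n * ∫ x, X x ^ 2 ∂μ := by
  have h := variance_sum_pi (μ := fun _ : Fin n => μ) (X := fun _ => X) fun _ => hX
  have hfun : (∑ i : Fin n, fun z : Fin n → α => X (z i)) = fun z => ∑ i, X (z i) := by
    ext z; simp
  rw [hfun, variance_of_integral_eq_zero (memLp_two_sum_pi hX).1.aemeasurable,
    Finset.sum_const, variance_of_integral_eq_zero hX.1.aemeasurable h0] at h
  · simpa using h
  · rw [integral_finsetSum (f := fun i (z : Fin n → α) => X (z i)) _ fun i _ => (measurePreserving_eval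
      (fun _ : Fin n => μ) i).integrable_comp_of_integrable (hX.integrable (by norm_num))]
    refine Finset.sum_eq_zero fun i _ => ?_
    have := integral_map (φ := Function.eval i) (μ := Measure.pi fun _ : Fin n => μ) (f := X)
      (measurable_pi_apply i).aemeasurable (by rw [(measurePreserving_eval (fun _ : Fin n => μ) i).map_eq]; exact hX.1)
    rw [(measurePreserving_eval (fun _ : Fin n => μ) i).map_eq, h0] at this
    exact this.symm

end Product

/-! ### Empirical second moments of a standard Gaussian sample. -/

section EmpiricalForms

variable {E : Type*} [NormedAddCommGroup E] [InnerProductSpace ℝ E] {n : ℕ}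

/-- The bilinear form of `√n (M_n - I)`, where `M_n` is the second-moment matrix of the sample. -/
noncomputable def empForm (a b : E) (z : Fin n → E) : ℝ :=
  (√(n : ℝ))⁻¹ * ∑ i, (⟪a, z i⟫ * ⟪b, z i⟫ - ⟪a, b⟫)

/-- The bilinear form of `√n z̄ z̄'`, where `z̄` is the mean of the sample. -/
noncomputable def meanForm (a b : E) (z : Fin n → E) : ℝ :=
  √(n : ℝ) * (⟪a, (1 / (n : ℝ)) • ∑ i, z i⟫ * ⟪b, (1 / (n : ℝ)) • ∑ i, z i⟫)

/-- Allows test vectors that vary with `n` to be replaced by their limits. -/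
lemma empForm_sub_empForm (a b a' b' : E) (z : Fin n → E) :
    empForm a b z - empForm a' b' z = empForm (a - a') b z + empForm a' (b - b') z := by
  simp only [empForm]
  rw [← mul_sub, ← mul_add, ← Finset.sum_sub_distrib, ← Finset.sum_add_distrib]
  congr 1
  refine Finset.sum_congr rfl fun i _ => ?_
  simp only [inner_sub_left, inner_sub_right]
  ring

variable [MeasurableSpace E] [BorelSpace E] [FiniteDimensional ℝ E]

lemma measurable_empForm (a b : E) : Measurable (empForm (n := n) a b) := by
  unfold empForm; fun_prop

lemma measurable_meanForm (a b : E) : Measurable (meanForm (n := n) a b) := by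
  unfold meanForm; fun_prop

lemma memLp_inner_mul_inner_stdGaussian (a b : E) :
    MemLp (fun z => ⟪a, z⟫ * ⟪b, z⟫) 2 (stdGaussian E) :=
  have : ENNReal.HolderTriple 4 4 2 := ⟨by
    rw [← two_mul, show (4 : ENNReal) = 2 * 2 by norm_num,
      ENNReal.mul_inv (by simp) (by simp), ← mul_assoc, ENNReal.mul_inv_cancel (by simp) (by simp),
      one_mul]⟩
  (memLp_inner_stdGaussian b 4 (by simp)).mul (memLp_inner_stdGaussian a 4 (by simp))

lemma integrable_norm_pow_stdGaussian (k : ℕ) : Integrable (fun z : E => ‖z‖ ^ k) (stdGaussian E) := by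
  have := (IsGaussian.memLp_id (stdGaussian E) k (by simp)).integrable_norm_pow'
  simpa using this

/-- Mean absolute values of the forms `empForm a b` are uniformly of order `‖a‖ ‖b‖`. -/
lemma exists_meanAbsLE_empForm (E : Type*) [NormedAddCommGroup E] [InnerProductSpace ℝ E]
    [MeasurableSpace E] [BorelSpace E] [FiniteDimensional ℝ E] :
    ∃ K : ℝ, 0 ≤ K ∧ ∀ n : ℕ, 1 ≤ n → ∀ a b : E,
      MeanAbsLE (Measure.pi fun _ : Fin n => stdGaussian E) (empForm a b) (K * (‖a‖ * ‖b‖)) := by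
  -- By Cauchy–Schwarz the variance of `⟪a, z⟫ ⟪b, z⟫` is at most `‖a‖² ‖b‖²` times the fourth
  -- moment of the norm.
  refine ⟨√(∫ z : E, ‖z‖ ^ 4 ∂(stdGaussian E)), Real.sqrt_nonneg _, fun n hn a b => ?_⟩
  have hX : MemLp (fun z => ⟪a, z⟫ * ⟪b, z⟫ - ⟪a, b⟫) 2 (stdGaussian E) :=
    (memLp_inner_mul_inner_stdGaussian a b).sub (memLp_const _)
  have hI := (memLp_inner_mul_inner_stdGaussian a b).integrable (by norm_num)
  have h0 : ∫ z, (⟪a, z⟫ * ⟪b, z⟫ - ⟪a, b⟫) ∂(stdGaussian E) = 0 := by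
    rw [integral_sub hI (integrable_const _), integral_inner_mul_inner_stdGaussian]
    simp
  have h2 : ∫ z, (⟪a, z⟫ * ⟪b, z⟫ - ⟪a, b⟫) ^ 2 ∂(stdGaussian E) ≤
      (‖a‖ * ‖b‖) ^ 2 * ∫ z : E, ‖z‖ ^ 4 ∂(stdGaussian E) := by
    have h3 := variance_eq_integral (memLp_inner_mul_inner_stdGaussian a b).1.aemeasurable
    rw [integral_inner_mul_inner_stdGaussian] at h3
    rw [← h3, ← integral_const_mul]
    refine (variance_le_expectation_sq (memLp_inner_mul_inner_stdGaussian a b).1).trans ?_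
    refine integral_mono (memLp_inner_mul_inner_stdGaussian a b).integrable_sq
      ((integrable_norm_pow_stdGaussian 4).const_mul _) fun z => ?_
    have h4 := abs_real_inner_le_norm a z
    have h5 := abs_real_inner_le_norm b z
    have h6 : |⟪a, z⟫ * ⟪b, z⟫| ≤ ‖a‖ * ‖b‖ * ‖z‖ ^ 2 := by
      rw [abs_mul]
      calc _ ≤ (‖a‖ * ‖z‖) * (‖b‖ * ‖z‖) := by gcongr
        _ = _ := by ring
    calc (⟪a, z⟫ * ⟪b, z⟫) ^ 2 = |⟪a, z⟫ * ⟪b, z⟫| ^ 2 := (sq_abs _).symm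
      _ ≤ (‖a‖ * ‖b‖ * ‖z‖ ^ 2) ^ 2 := by gcongr
      _ = _ := by ring
  refine MeanAbsLE.of_sq ((memLp_two_sum_pi hX).const_mul _) (by positivity) ?_
  have hn' : (0 : ℝ) < n := by exact_mod_cast hn
  simp only [empForm, mul_pow, inv_pow]
  rw [integral_const_mul, integral_sq_sum_pi hX h0, Real.sq_sqrt hn'.le, ← mul_assoc,
    inv_mul_cancel₀ hn'.ne', one_mul, Real.sq_sqrt (by positivity), mul_comm]
  rw [mul_pow] at h2
  linarith

/-- Cauchy–Schwarz bounds the form by `n^(-3/2) ‖a‖ ‖b‖ ‖∑ z i‖²`, and the expected squared norm of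
the sum, computed in an orthonormal basis, is `n` times the dimension. -/
lemma meanAbsLE_meanForm (hn : 1 ≤ n) (a b : E) :
    MeanAbsLE (Measure.pi fun _ : Fin n => stdGaussian E) (meanForm a b)
      (Module.finrank ℝ E * (‖a‖ * ‖b‖) / √(n : ℝ)) := by
  set Q := Measure.pi fun _ : Fin n => stdGaussian E
  have hn' : (0 : ℝ) < n := by exact_mod_cast hn
  have hL : ∀ c : E, MemLp (fun z : Fin n → E => ∑ i, ⟪c, z i⟫) 2 Q := fun c =>
    memLp_two_sum_pi (memLp_inner_stdGaussian c 2 (by simp))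
  have hsq : ∀ c : E, ∫ z : Fin n → E, (∑ i, ⟪c, z i⟫) ^ 2 ∂Q = n * ‖c‖ ^ 2 := fun c => by
    rw [integral_sq_sum_pi (memLp_inner_stdGaussian c 2 (by simp)) (integral_inner_stdGaussian c)]
    simp_rw [sq, integral_inner_mul_inner_stdGaussian, real_inner_self_eq_norm_mul_norm]
  have hform : ∀ z : Fin n → E, meanForm a b z =
      √(n : ℝ) * (1 / n) ^ 2 * ((∑ i, ⟪a, z i⟫) * (∑ i, ⟪b, z i⟫)) := fun z => by
    simp only [meanForm, inner_smul_right, inner_sum]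
    ring
  set e := stdOrthonormalBasis ℝ E
  have hbound : ∀ z : Fin n → E, |meanForm a b z| ≤
      √(n : ℝ) * (1 / n) ^ 2 * (‖a‖ * ‖b‖) * ∑ j, (∑ i, ⟪e j, z i⟫) ^ 2 := fun z => by
    have h1 : ∑ j, (∑ i, ⟪e j, z i⟫) ^ 2 = ‖∑ i, z i‖ ^ 2 := by
      simp_rw [← inner_sum]
      exact e.sum_sq_inner_right _
    rw [h1, hform, ← inner_sum, ← inner_sum, abs_mul _ (_ * _),
      abs_mul ⟪_, _⟫, abs_of_nonneg (a := √(n : ℝ) * (1 / n) ^ 2) (by positivity)]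
    have h2 := abs_real_inner_le_norm a (∑ i, z i)
    have h3 := abs_real_inner_le_norm b (∑ i, z i)
    rw [mul_assoc _ (‖a‖ * ‖b‖)]
    refine mul_le_mul_of_nonneg_left ?_ (by positivity)
    calc _ ≤ (‖a‖ * ‖∑ i, z i‖) * (‖b‖ * ‖∑ i, z i‖) := by gcongr
      _ = _ := by ring
  have hint : Integrable (meanForm a b) Q := by
    have := ((hL a).integrable_mul (hL b)).const_mul (√(n : ℝ) * (1 / n) ^ 2)
    exact this.congr (ae_of_all _ fun z => (hform z).symm)
  refine ⟨hint, ?_⟩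
  calc ∫ z, |meanForm a b z| ∂Q
      ≤ ∫ z, √(n : ℝ) * (1 / n) ^ 2 * (‖a‖ * ‖b‖) * ∑ j, (∑ i, ⟪e j, z i⟫) ^ 2 ∂Q :=
        integral_mono hint.abs ((integrable_finsetSum _ fun j _ =>
          (hL (e j)).integrable_sq).const_mul _) hbound
    _ = √(n : ℝ) * (1 / n) ^ 2 * (‖a‖ * ‖b‖) * (Module.finrank ℝ E * n) := by
        rw [integral_const_mul, integral_finsetSum _ fun j _ => (hL (e j)).integrable_sq]
        simp_rw [hsq, e.orthonormal.norm_eq_one]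
        simp
    _ = _ := by
        rw [eq_div_iff (by positivity)]
        have := Real.mul_self_sqrt hn'.le
        field_simp
        linear_combination ‖a‖ * ‖b‖ * (Module.finrank ℝ E : ℝ) * this

/-- Orthogonality makes `⟪a, z⟫` and `⟪b, z⟫` independent, so their product is centred with variance
`‖a‖² ‖b‖²`, and the classical central limit theorem applies. -/
lemma tendsto_integral_cexp_empForm {a b : E} (hab : ⟪a, b⟫ = 0) :
    Tendsto (fun n : ℕ => ∫ z, Complex.exp (empForm a b z * Complex.I)
      ∂(Measure.pi fun _ : Fin n => stdGaussian E)) atTop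
      (𝓝 (Complex.exp (-(‖a‖ ^ 2 * ‖b‖ ^ 2) / 2 : ℝ))) := by
  -- In the degenerate case the product cannot be standardised, but the form vanishes identically.
  by_cases hσ : ‖a‖ * ‖b‖ = 0
  · have h0 : ∀ n, ∀ z : Fin n → E, empForm a b z = 0 := fun n z => by
      rcases mul_eq_zero.1 hσ with h | h <;> rw [norm_eq_zero] at h <;> simp [empForm, h]
    rw [← mul_pow, hσ]
    simp [h0]
  set σ := ‖a‖ * ‖b‖ with hσdef
  set X : E → ℝ := fun z => σ⁻¹ * (⟪a, z⟫ * ⟪b, z⟫) with hX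
  have hXm : Measurable X := by fun_prop
  have h0 : (stdGaussian E)[X] = 0 := by
    rw [hX, integral_const_mul, integral_inner_mul_inner_stdGaussian, hab, mul_zero]
  have h1 : (stdGaussian E)[X ^ 2] = 1 := by
    have hc : ∀ c : E, ∫ z, ⟪c, z⟫ ^ 2 ∂(stdGaussian E) = ‖c‖ ^ 2 := fun c => by
      simp_rw [sq, integral_inner_mul_inner_stdGaussian, real_inner_self_eq_norm_mul_norm]
    have h2 := (indepFun_inner_stdGaussian hab).integral_fun_comp_mul_comp
      (f := fun y : ℝ => y ^ 2) (g := fun y : ℝ => y ^ 2) (by fun_prop) (by fun_prop)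
      (by fun_prop) (by fun_prop)
    simp only [hX, Pi.pow_apply, mul_pow]
    rw [integral_const_mul, h2, hc, hc, ← mul_pow, ← hσdef, inv_pow,
      inv_mul_cancel₀ (pow_ne_zero 2 hσ)]
  have hlim := tendsto_charFun_inv_sqrt_mul_pow hXm.aemeasurable h0 h1 σ
  have hexp : Complex.exp (-(σ : ℂ) ^ 2 / 2) = Complex.exp (-(‖a‖ ^ 2 * ‖b‖ ^ 2) / 2 : ℝ) := by
    rw [hσdef]; congr 1; push_cast; ring
  rw [hexp] at hlim
  refine hlim.congr fun n => ?_
  rw [charFun_apply_real, integral_map hXm.aemeasurable (by fun_prop)]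
  have h3 := integral_fintype_prod_eq_pow (μ := stdGaussian E) (ι := Fin n)
    (fun z => Complex.exp (((√(n : ℝ))⁻¹ * (⟪a, z⟫ * ⟪b, z⟫) : ℝ) * Complex.I))
  rw [Fintype.card_fin] at h3
  convert! h3.symm using 1
  · congr 1
    refine integral_congr_ae (ae_of_all _ fun z => ?_)
    simp only [hX]
    congr 2
    rw [← Complex.ofReal_mul]
    congr 1
    field_simp
  · refine integral_congr_ae (ae_of_all _ fun z => ?_)
    simp only [empForm, hab, sub_zero]
    rw [← Complex.exp_sum, ← Finset.sum_mul, ← Complex.ofReal_sum, Finset.mul_sum]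

end EmpiricalForms

/-! ### Bilinear forms of the sample covariance matrix. -/

section Forms

variable {p : ℕ}

lemma inner_toEuclideanLin (A : Matrix (Fin p) (Fin p) ℝ) (a b : EuclideanSpace ℝ (Fin p)) :
    ⟪a, toEuclideanLin A b⟫ = a.ofLp ⬝ᵥ A *ᵥ b.ofLp := by
  rw [← dotProduct_eq_inner]
  rfl

lemma inner_toEuclideanLin_outer (θ a b : EuclideanSpace ℝ (Fin p)) :
    ⟪a, toEuclideanLin (outer θ) b⟫ = ⟪θ, a⟫ * ⟪θ, b⟫ := by
  rw [inner_toEuclideanLin, dotProduct_outer_mulVec]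

/-- The bilinear form of the scaled deviation of the sample covariance matrix. -/
noncomputable def devForm {n : ℕ} (θ : EuclideanSpace ℝ (Fin p)) (r v : ℝ)
    (a b : EuclideanSpace ℝ (Fin p)) (x : Sample p n) : ℝ :=
  ⟪a, toEuclideanLin (scaledDev θ r v x) b⟫

lemma inner_toEuclideanLin_one_sub_outer (θ a b : EuclideanSpace ℝ (Fin p)) :
    ⟪a, toEuclideanLin (1 - outer θ) b⟫ = ⟪a, b⟫ - ⟪θ, a⟫ * ⟪θ, b⟫ := by
  rw [map_sub, LinearMap.sub_apply, inner_sub_right, inner_toEuclideanLin_outer,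
    inner_toEuclideanLin, Matrix.one_mulVec, dotProduct_eq_inner]

lemma inner_toEuclideanLin_one_sub_outer_mul_scaledDev {n : ℕ} (θ : EuclideanSpace ℝ (Fin p))
    (r v : ℝ) (a b : EuclideanSpace ℝ (Fin p)) (x : Sample p n) :
    ⟪a, toEuclideanLin ((1 - outer θ) * scaledDev θ r v x) b⟫ =
      devForm θ r v (a - ⟪θ, a⟫ • θ) b x := by
  have h : toEuclideanLin ((1 - outer θ) * scaledDev θ r v x) b =
      toEuclideanLin (1 - outer θ) (toEuclideanLin (scaledDev θ r v x) b) := by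
    ext i
    simp [Matrix.toLpLin_apply, Matrix.mulVec_mulVec]
  rw [h, inner_toEuclideanLin_one_sub_outer, devForm, inner_sub_left, inner_smul_left]
  rfl

lemma inner_toEuclideanLin_sampleCov {n : ℕ} (hn : 1 ≤ n) (a b : EuclideanSpace ℝ (Fin p))
    (x : Sample p n) :
    ⟪a, toEuclideanLin (sampleCov x) b⟫ =
      1 / n * ∑ i, ⟪a, x i⟫ * ⟪b, x i⟫ - ⟪a, sampleMean x⟫ * ⟪b, sampleMean x⟫ := by
  have hn' : (n : ℝ) ≠ 0 := by positivity
  have hmean : ∀ c : EuclideanSpace ℝ (Fin p), ∑ i, ⟪c, x i⟫ = n * ⟪c, sampleMean x⟫ := fun c => by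
    rw [sampleMean, inner_smul_right, inner_sum]
    field_simp
  rw [sampleCov, map_smul, LinearMap.smul_apply, inner_smul_right, map_sum, LinearMap.sum_apply,
    inner_sum]
  have h : ∀ i, ⟪a, toEuclideanLin (outer (x i - sampleMean x)) b⟫ =
      ⟪a, x i⟫ * ⟪b, x i⟫ - ⟪a, sampleMean x⟫ * ⟪b, x i⟫ - ⟪b, sampleMean x⟫ * ⟪a, x i⟫ +
        ⟪a, sampleMean x⟫ * ⟪b, sampleMean x⟫ := fun i => by
    rw [inner_toEuclideanLin_outer, real_inner_comm a, real_inner_comm b, inner_sub_right,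
      inner_sub_right]
    ring
  simp_rw [h]
  rw [Finset.sum_add_distrib, Finset.sum_sub_distrib, Finset.sum_sub_distrib, ← Finset.mul_sum,
    ← Finset.mul_sum, hmean, hmean]
  simp only [Finset.sum_const, Finset.card_univ, Fintype.card_fin, nsmul_eq_mul]
  field_simp
  ring

/-- Adding the mean form undoes the centring at the sample mean and leaves a sum of independent
terms. -/
lemma devForm_add_meanForm {n : ℕ} (hn : 1 ≤ n) (θ : EuclideanSpace ℝ (Fin p)) (r v : ℝ)
    (a b : EuclideanSpace ℝ (Fin p)) (x : Sample p n) :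
    devForm θ r v a b x + meanForm a b x =
      √(n : ℝ) * (1 / n * ∑ i, ⟪a, x i⟫ * ⟪b, x i⟫ - (⟪a, b⟫ + r * v * (⟪θ, a⟫ * ⟪θ, b⟫))) := by
  have h1 : ⟪a, toEuclideanLin (spikedCov θ r v) b⟫ = ⟪a, b⟫ + r * v * (⟪θ, a⟫ * ⟪θ, b⟫) := by
    rw [spikedCov, map_add, map_smul, LinearMap.add_apply, LinearMap.smul_apply, inner_add_right,
      inner_smul_right, inner_toEuclideanLin_outer, inner_toEuclideanLin, Matrix.one_mulVec,
      dotProduct_eq_inner]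
  rw [devForm, scaledDev, map_smul, map_sub, LinearMap.smul_apply, LinearMap.sub_apply,
    inner_smul_right, inner_sub_right, inner_toEuclideanLin_sampleCov hn, h1, meanForm]
  simp only [sampleMean]
  ring

lemma meanForm_spikeMap {n : ℕ} (θ : EuclideanSpace ℝ (Fin p)) (s : ℝ)
    (a b : EuclideanSpace ℝ (Fin p)) (z : Sample p n) :
    meanForm a b (fun i => spikeMap θ s (z i)) =
      meanForm (spikeMap θ s a) (spikeMap θ s b) z := by
  simp only [meanForm, ← map_sum, ← map_smul, inner_spikeMap_right]

/-- The inner product of the transformed test vectors is the form of the spiked covariance, so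
centring at that matrix becomes centring at the identity. -/
lemma devForm_spikeMap {n : ℕ} (hn : 1 ≤ n) {θ : EuclideanSpace ℝ (Fin p)} (hθ : ‖θ‖ = 1)
    {r v : ℝ} (hrv : 0 ≤ r * v) (a b : EuclideanSpace ℝ (Fin p)) (z : Sample p n) :
    devForm θ r v a b (fun i => spikeMap θ √(1 + r * v) (z i)) =
      empForm (spikeMap θ √(1 + r * v) a) (spikeMap θ √(1 + r * v) b) z -
        meanForm (spikeMap θ √(1 + r * v) a) (spikeMap θ √(1 + r * v) b) z := by
  rw [eq_sub_iff_add_eq, ← meanForm_spikeMap, devForm_add_meanForm hn, empForm]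
  have hn' : (0 : ℝ) < n := by exact_mod_cast hn
  rw [Finset.sum_sub_distrib, inner_spikeMap_spikeMap hθ, Real.sq_sqrt (by linarith)]
  simp only [inner_spikeMap_right]
  simp only [Finset.sum_const, Finset.card_univ, Fintype.card_fin, nsmul_eq_mul]
  have h := Real.mul_self_sqrt hn'.le
  field_simp
  rw [sq, h]
  ring

lemma measurable_devForm {n : ℕ} (θ : EuclideanSpace ℝ (Fin p)) (r v : ℝ)
    (a b : EuclideanSpace ℝ (Fin p)) : Measurable (devForm (n := n) θ r v a b) := by
  rcases Nat.eq_zero_or_pos n with rfl | hn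
  · exact measurable_of_countable _
  · have h : devForm (n := n) θ r v a b = fun x => √(n : ℝ) * (1 / n * ∑ i, ⟪a, x i⟫ * ⟪b, x i⟫ -
        (⟪a, b⟫ + r * v * (⟪θ, a⟫ * ⟪θ, b⟫))) - meanForm a b x := by
      ext x
      rw [← devForm_add_meanForm hn, add_sub_cancel_right]
    rw [h]
    have := measurable_meanForm (n := n) a b
    fun_prop

lemma norm_spikeMap_le {θ : EuclideanSpace ℝ (Fin p)} (hθ : ‖θ‖ = 1) {u U : ℝ} (hu : 0 ≤ u)
    (hU : u ≤ U) (a : EuclideanSpace ℝ (Fin p)) : ‖spikeMap θ √(1 + u) a‖ ≤ √(1 + U) * ‖a‖ := by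
  refine abs_le_of_sq_le_sq' ?_ (by positivity) |>.2
  have h1 := inner_spikeMap_spikeMap hθ √(1 + u) a a
  rw [real_inner_self_eq_norm_sq, real_inner_self_eq_norm_sq, Real.sq_sqrt (by linarith)] at h1
  rw [h1, mul_pow, Real.sq_sqrt (by linarith)]
  have h2 := abs_real_inner_le_norm θ a
  rw [hθ, one_mul] at h2
  have h3 : ⟪θ, a⟫ * ⟪θ, a⟫ ≤ ‖a‖ ^ 2 := by
    rw [← sq, ← sq_abs]; gcongr
  have h4 : 0 ≤ ⟪θ, a⟫ * ⟪θ, a⟫ := mul_self_nonneg _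
  nlinarith [sq_nonneg ‖a‖]

/-- Under bounded spikes the forms `devForm a b` are of order `‖a‖ ‖b‖` in mean absolute value, and
the contribution of the sample mean is smaller by a factor `√n`. -/
lemma exists_meanAbsLE_forms {θ : EuclideanSpace ℝ (Fin p)} (hθ : ‖θ‖ = 1) {v : ℝ} (hv : 0 < v)
    (R : ℝ) : ∃ K : ℝ, 0 ≤ K ∧ ∀ n : ℕ, 1 ≤ n → ∀ r : ℝ, 0 < r → r ≤ R →
      ∀ a b : EuclideanSpace ℝ (Fin p),
        MeanAbsLE (sampleLaw n θ r v) (devForm θ r v a b) (K * (‖a‖ * ‖b‖)) ∧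
        MeanAbsLE (sampleLaw n θ r v) (meanForm a b) (K * (‖a‖ * ‖b‖) * (√(n : ℝ))⁻¹) := by
  obtain ⟨K, hK0, hK⟩ := exists_meanAbsLE_empForm (EuclideanSpace ℝ (Fin p))
  set N : ℝ := 1 + |R * v|
  have hN : 0 ≤ N := by positivity
  -- `K` comes from the empirical form, `p` from the mean form, and `N` bounds the squared operator
  -- norm of the spike map.
  refine ⟨(K + p) * N, by positivity, fun n hn r hr hrR a b => ?_⟩
  have hn1 : 1 ≤ √(n : ℝ) := Real.one_le_sqrt.2 (by exact_mod_cast hn)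
  have hrv : 0 ≤ r * v := by positivity
  have hle : r * v ≤ |R * v| := (mul_le_mul_of_nonneg_right hrR hv.le).trans (le_abs_self _)
  have hab : ‖spikeMap θ √(1 + r * v) a‖ * ‖spikeMap θ √(1 + r * v) b‖ ≤ N * (‖a‖ * ‖b‖) := by
    calc _ ≤ (√(1 + |R * v|) * ‖a‖) * (√(1 + |R * v|) * ‖b‖) :=
          mul_le_mul (norm_spikeMap_le hθ hrv hle a) (norm_spikeMap_le hθ hrv hle b)
            (norm_nonneg _) (by positivity)
      _ = (√(1 + |R * v|) * √(1 + |R * v|)) * (‖a‖ * ‖b‖) := by ring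
      _ = _ := by rw [Real.mul_self_sqrt hN]
  have hmean := meanAbsLE_meanForm hn (spikeMap θ √(1 + r * v) a) (spikeMap θ √(1 + r * v) b)
  rw [finrank_euclideanSpace_fin] at hmean
  have hmean_le : p * (‖spikeMap θ √(1 + r * v) a‖ * ‖spikeMap θ √(1 + r * v) b‖) / √(n : ℝ) ≤
      p * (N * (‖a‖ * ‖b‖)) * (√(n : ℝ))⁻¹ := by
    rw [div_eq_mul_inv]; gcongr
  have hmeas : Measurable fun (z : Sample p n) i => spikeMap θ √(1 + r * v) (z i) := by fun_prop
  have hinv : (√(n : ℝ))⁻¹ ≤ 1 := inv_le_one_of_one_le₀ hn1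
  rw [sampleLaw_eq_map n hθ hr hv]
  constructor
  · refine MeanAbsLE.map hmeas (measurable_devForm _ _ _ _ _) ?_
    simp_rw [devForm_spikeMap hn hθ hrv]
    refine ((hK n hn _ _).sub (hmean.mono hmean_le)).mono ?_
    calc _ ≤ K * (N * (‖a‖ * ‖b‖)) + p * (N * (‖a‖ * ‖b‖)) * 1 := by gcongr
      _ = _ := by ring
  · refine MeanAbsLE.map hmeas (measurable_meanForm _ _) ?_
    simp_rw [meanForm_spikeMap]
    refine hmean.mono (hmean_le.trans ?_)
    rw [← mul_assoc (p : ℝ), mul_assoc ((K + p) * N)]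
    rw [mul_assoc ((p : ℝ) * N)]
    gcongr
    linarith

/-- After transport to the standard sample, the moving test vectors are replaced by their limits at
a vanishing cost in mean absolute value. Orthogonality is thus needed only in the limit. -/
lemma tendsto_integral_cexp_devForm {θ : EuclideanSpace ℝ (Fin p)} (hθ : ‖θ‖ = 1) {v : ℝ}
    (hv : 0 < v) {r : ℕ → ℝ} (hr : ∀ n, 1 ≤ n → 0 < r n) {ρ : ℝ} (hρ : Tendsto r atTop (𝓝 ρ))
    {a b : ℕ → EuclideanSpace ℝ (Fin p)} {a' b' : EuclideanSpace ℝ (Fin p)}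
    (ha : Tendsto a atTop (𝓝 a')) (hb : Tendsto b atTop (𝓝 b'))
    (hab : ⟪spikeMap θ √(1 + ρ * v) a', spikeMap θ √(1 + ρ * v) b'⟫ = 0) :
    Tendsto (fun n => ∫ x, Complex.exp (devForm θ (r n) v (a n) (b n) x * Complex.I)
      ∂(sampleLaw n θ (r n) v)) atTop
      (𝓝 (Complex.exp (-(‖spikeMap θ √(1 + ρ * v) a'‖ ^ 2 *
        ‖spikeMap θ √(1 + ρ * v) b'‖ ^ 2) / 2 : ℝ))) := by
  obtain ⟨K, hK0, hK⟩ := exists_meanAbsLE_empForm (EuclideanSpace ℝ (Fin p))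
  have hs : ∀ {c : ℕ → EuclideanSpace ℝ (Fin p)} {c' : EuclideanSpace ℝ (Fin p)},
      Tendsto c atTop (𝓝 c') → Tendsto (fun n => spikeMap θ √(1 + r n * v) (c n)) atTop
        (𝓝 (spikeMap θ √(1 + ρ * v) c')) := fun {c c'} hc => by
    simp only [spikeMap_apply]
    have h1 : Tendsto (fun n => √(1 + r n * v)) atTop (𝓝 √(1 + ρ * v)) :=
      ((hρ.mul_const v).const_add 1).sqrt
    exact hc.add (((h1.sub_const 1).mul (tendsto_const_nhds.inner hc)).smul_const θ)
  have hA := hs ha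
  have hB := hs hb
  set A := fun n => spikeMap θ √(1 + r n * v) (a n)
  set B := fun n => spikeMap θ √(1 + r n * v) (b n)
  set A' := spikeMap θ √(1 + ρ * v) a'
  set B' := spikeMap θ √(1 + ρ * v) b'
  -- The three terms pay for replacing `A n`, replacing `B n`, and dropping the mean form.
  set c : ℕ → ℝ := fun n => K * (‖A n - A'‖ * ‖B n‖) + K * (‖A'‖ * ‖B n - B'‖) +
    p * (‖A n‖ * ‖B n‖) * (√(n : ℝ))⁻¹
  have hinv : Tendsto (fun n : ℕ => (√(n : ℝ))⁻¹) atTop (𝓝 0) :=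
    tendsto_inv_atTop_zero.comp (Real.tendsto_sqrt_atTop.comp tendsto_natCast_atTop_atTop)
  have hA0 : Tendsto (fun n => ‖A n - A'‖) atTop (𝓝 0) := by
    simpa using (hA.sub_const A').norm
  have hB0 : Tendsto (fun n => ‖B n - B'‖) atTop (𝓝 0) := by
    simpa using (hB.sub_const B').norm
  have hc : Tendsto c atTop (𝓝 0) := by
    have := (((hA0.mul hB.norm).const_mul K).add ((hB0.const_mul ‖A'‖).const_mul K)).add
      (((hA.norm.mul hB.norm).const_mul (p : ℝ)).mul hinv)
    simpa using this
  have hlim := tendsto_integral_cexp_empForm hab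
  refine (tendsto_iff_of_dist ?_).1 hlim
  refine squeeze_zero' (Eventually.of_forall fun _ => dist_nonneg) ?_ hc
  filter_upwards [eventually_ge_atTop 1] with n hn
  have hrv : 0 ≤ r n * v := (mul_pos (hr n hn) hv).le
  rw [dist_comm, dist_eq_norm, sampleLaw_eq_map n hθ (hr n hn) hv,
    integral_map (Measurable.aemeasurable (by fun_prop)) (by
      have := measurable_devForm (n := n) θ (r n) v (a n) (b n)
      exact Measurable.aestronglyMeasurable (by fun_prop))]
  simp_rw [devForm_spikeMap hn hθ hrv]
  refine norm_integral_cexp_sub_le ((measurable_empForm _ _).sub (measurable_meanForm _ _))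
    (measurable_empForm _ _) ?_
  have h1 := ((hK n hn (A n - A') (B n)).add (hK n hn A' (B n - B'))).sub
    (meanAbsLE_meanForm hn (A n) (B n))
  rw [finrank_euclideanSpace_fin, div_eq_mul_inv] at h1
  convert! h1 using 1
  ext z
  rw [← empForm_sub_empForm, Pi.sub_apply]
  ring

end Forms

/-- Lévy's continuity theorem, for variables on changing probability spaces. -/
lemma tendstoInDistribution_of_tendsto_charFun {E : Type*} [NormedAddCommGroup E]
    [InnerProductSpace ℝ E] [FiniteDimensional ℝ E] [MeasurableSpace E] [BorelSpace E]
    {Ω : ℕ → Type*} [∀ n, MeasurableSpace (Ω n)] {P : ∀ n, Measure (Ω n)}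
    [∀ n, IsProbabilityMeasure (P n)] {Y : ∀ n, Ω n → E} (hY : ∀ n, Measurable (Y n))
    {μ : Measure E} [IsProbabilityMeasure μ]
    (h : ∀ t : E, Tendsto (fun n => ∫ ω, Complex.exp (⟪Y n ω, t⟫ * Complex.I) ∂(P n)) atTop
      (𝓝 (charFun μ t))) :
    TendstoInDistribution Y atTop id P μ where
  forall_aemeasurable n := (hY n).aemeasurable
  aemeasurable_limit := aemeasurable_id
  tendsto := by
    refine ProbabilityMeasure.tendsto_iff_tendsto_charFun.2 fun t => ?_
    simp only [ProbabilityMeasure.coe_mk, Measure.map_id]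
    refine (h t).congr fun n => ?_
    rw [charFun_apply, integral_map (hY n).aemeasurable
      (Measurable.aestronglyMeasurable (by fun_prop))]

lemma norm_le_two_of_norm_add_eq_one {E : Type*} [SeminormedAddCommGroup E] {θ δ : E}
    (hθ : ‖θ‖ = 1) (hδ : ‖θ + δ‖ = 1) : ‖δ‖ ≤ 2 := by
  calc ‖δ‖ = ‖(θ + δ) - θ‖ := by rw [add_sub_cancel_left]
    _ ≤ ‖θ + δ‖ + ‖θ‖ := norm_sub_le _ _
    _ = 2 := by rw [hθ, hδ]; norm_num

/-! ### Chords of the unit sphere. -/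

section UnitVectors

variable {E : Type*} [NormedAddCommGroup E] [InnerProductSpace ℝ E] {θ δ : E}

lemma inner_of_norm_add_eq_one (hθ : ‖θ‖ = 1) (hδ : ‖θ + δ‖ = 1) :
    ⟪θ, δ⟫ = -(‖δ‖ ^ 2 / 2) := by
  have h := norm_add_sq_real θ δ
  rw [hθ, hδ] at h
  linarith

/-- A chord is orthogonal to the vector from the centre to its midpoint. Hence the identity part of
the covariance contributes nothing to the mean of the log-likelihood ratio. -/
lemma inner_add_half_smul (hθ : ‖θ‖ = 1) (hδ : ‖θ + δ‖ = 1) :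
    ⟪δ, θ + (1 / 2 : ℝ) • δ⟫ = 0 := by
  rw [inner_add_right, inner_smul_right, real_inner_comm, inner_of_norm_add_eq_one hθ hδ,
    real_inner_self_eq_norm_sq]
  ring

lemma inner_self_add_half_smul (hθ : ‖θ‖ = 1) (hδ : ‖θ + δ‖ = 1) :
    ⟪θ, θ + (1 / 2 : ℝ) • δ⟫ = 1 - ‖δ‖ ^ 2 / 4 := by
  rw [inner_add_right, inner_smul_right, inner_of_norm_add_eq_one hθ hδ,
    real_inner_self_eq_norm_sq, hθ]
  ring

lemma norm_add_half_smul_sq (hθ : ‖θ‖ = 1) (hδ : ‖θ + δ‖ = 1) :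
    ‖θ + (1 / 2 : ℝ) • δ‖ ^ 2 = 1 - ‖δ‖ ^ 2 / 4 := by
  rw [← real_inner_self_eq_norm_sq, inner_add_left, inner_self_add_half_smul hθ hδ,
    inner_smul_left, inner_add_half_smul hθ hδ]
  simp

end UnitVectors

/-! ### Expansions of the log-likelihood ratio. -/

section Expansion

variable {p : ℕ}

lemma logRatio_eq {n : ℕ} (hn : 1 ≤ n) {θ δ : EuclideanSpace ℝ (Fin p)} (hθ : ‖θ‖ = 1)
    (hδ : ‖θ + δ‖ = 1) (r v : ℝ) (x : Sample p n) :
    logRatio (r * v) θ (θ + δ) x =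
      √(n : ℝ) * (r * v / (1 + r * v)) * (devForm θ r v δ (θ + (1 / 2 : ℝ) • δ) x +
        meanForm δ (θ + (1 / 2 : ℝ) • δ) x) -
      n * (r * v / (1 + r * v)) * (r * v) * (‖δ‖ ^ 2 / 2 * (1 - ‖δ‖ ^ 2 / 4)) := by
  have hn' : (0 : ℝ) < n := by exact_mod_cast hn
  have hsum : ∀ i, ⟪θ + δ, x i⟫ ^ 2 - ⟪θ, x i⟫ ^ 2 =
      2 * (⟪δ, x i⟫ * ⟪θ + (1 / 2 : ℝ) • δ, x i⟫) := fun i => by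
    simp only [inner_add_left, inner_smul_left, conj_trivial]
    ring
  rw [devForm_add_meanForm hn, inner_add_half_smul hθ hδ, inner_of_norm_add_eq_one hθ hδ,
    inner_self_add_half_smul hθ hδ, logRatio]
  simp_rw [hsum]
  rw [← Finset.mul_sum]
  generalize ∑ i, ⟪δ, x i⟫ * ⟪θ + (1 / 2 : ℝ) • δ, x i⟫ = S
  generalize r * v / (1 + r * v) = c
  have h := Real.mul_self_sqrt hn'.le
  have h2 : √(n : ℝ) * c * (√(n : ℝ) * (1 / n * S - (0 + r * v * (-(‖δ‖ ^ 2 / 2) *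
      (1 - ‖δ‖ ^ 2 / 4))))) = (√(n : ℝ) * √(n : ℝ)) * c * (1 / n * S - (0 + r * v *
      (-(‖δ‖ ^ 2 / 2) * (1 - ‖δ‖ ^ 2 / 4)))) := by ring
  rw [h2, h]
  field_simp
  ring

lemma logLik_ae_eq {n : ℕ} (hn : 1 ≤ n) {θ τ : EuclideanSpace ℝ (Fin p)} {ν : ℝ} (hθ : ‖θ‖ = 1)
    (hτ : ‖θ + ν • τ‖ = 1) {r v : ℝ} (hr : 0 < r) (hv : 0 < v) :
    logLik n θ r v ν τ =ᵐ[sampleLaw n θ r v] fun x =>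
      √(n : ℝ) * (r * v / (1 + r * v)) * (devForm θ r v (ν • τ) (θ + (1 / 2 : ℝ) • ν • τ) x +
        meanForm (ν • τ) (θ + (1 / 2 : ℝ) • ν • τ) x) -
      n * (r * v / (1 + r * v)) * (r * v) * (‖ν • τ‖ ^ 2 / 2 * (1 - ‖ν • τ‖ ^ 2 / 4)) := by
  filter_upwards [llr_sampleLaw n hθ hτ hr hv] with x hx
  rw [logLik, hx, logRatio_eq hn hθ hτ]

lemma tendsto_inv_sqrt_natCast : Tendsto (fun n : ℕ => (√(n : ℝ))⁻¹) atTop (𝓝 0) :=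
  tendsto_inv_atTop_zero.comp (Real.tendsto_sqrt_atTop.comp tendsto_natCast_atTop_atTop)

/-- Gives the limits of the random and the deterministic coefficient in the exact formula; `s` is
the local rate, or `1` when the whole chord is kept in the forms. -/
lemma tendsto_spike_coefficients {v : ℝ} (hv : 0 < v) {r s : ℕ → ℝ} {ρ ℓ : ℝ} (hρ0 : 0 ≤ ρ)
    (hρ : Tendsto r atTop (𝓝 ρ)) (hs : Tendsto (fun n : ℕ => √(n : ℝ) * r n * s n) atTop (𝓝 ℓ)) :
    Tendsto (fun n : ℕ => √(n : ℝ) * (r n * v / (1 + r n * v)) * s n) atTop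
      (𝓝 (ℓ * (v / (1 + ρ * v)))) ∧
    Tendsto (fun n : ℕ => n * (r n * v / (1 + r n * v)) * (r n * v) * s n ^ 2) atTop
      (𝓝 (ℓ ^ 2 * (v ^ 2 / (1 + ρ * v)))) := by
  have hne : 1 + ρ * v ≠ 0 := by positivity
  have h1 : Tendsto (fun n => 1 + r n * v) atTop (𝓝 (1 + ρ * v)) := (hρ.mul_const v).const_add 1
  refine ⟨(hs.mul ((tendsto_const_nhds (x := v)).div h1 hne)).congr fun n => ?_,
    ((hs.pow 2).mul ((tendsto_const_nhds (x := v ^ 2)).div h1 hne)).congr fun n => ?_⟩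
  · simp only [Pi.div_apply]
    ring
  · simp only [Pi.div_apply]
    rw [mul_pow, mul_pow, Real.sq_sqrt (Nat.cast_nonneg n)]
    ring

/-- The quadratic expansion of the log-likelihood ratio for directions at a fixed distance, when
the spikes are at most of order `1 / √n`. -/
lemma isLittleOP_logLik_sub_of_weak_spike {θ : EuclideanSpace ℝ (Fin p)} (hθ : ‖θ‖ = 1) {v : ℝ}
    (hv : 0 < v) {r : ℕ → ℝ} (hr : ∀ n, 1 ≤ n → 0 < r n) {R : ℝ} (hR : ∀ n, 1 ≤ n → r n ≤ R)
    {ℓ : ℝ} (hℓ : Tendsto (fun n : ℕ => √(n : ℝ) * r n) atTop (𝓝 ℓ))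
    {ν : ℕ → ℝ} {τ : ℕ → EuclideanSpace ℝ (Fin p)} (hτ : ∀ n, 1 ≤ n → ‖θ + ν n • τ n‖ = 1) :
    IsLittleOP (fun n => sampleLaw n θ (r n) v) (fun n x => logLik n θ (r n) v (ν n) (τ n) x -
      (ℓ * v * devForm θ (r n) v (ν n • τ n) (θ + (1 / 2 : ℝ) • ν n • τ n) x -
        ℓ ^ 2 * v ^ 2 * (‖ν n • τ n‖ ^ 2 / 2 * (1 - ‖ν n • τ n‖ ^ 2 / 4)))) := by
  obtain ⟨K, hK0, hK⟩ := exists_meanAbsLE_forms hθ hv R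
  have hr0 : Tendsto r atTop (𝓝 0) := by
    have h := hℓ.mul tendsto_inv_sqrt_natCast
    rw [mul_zero] at h
    refine h.congr' ?_
    filter_upwards [eventually_ge_atTop 1] with n hn
    have : (0 : ℝ) < √(n : ℝ) := Real.sqrt_pos.2 (by exact_mod_cast hn)
    field_simp
  obtain ⟨hκ, hϖ⟩ := tendsto_spike_coefficients (s := fun _ => 1) hv le_rfl hr0 (by simpa using hℓ)
  simp only [mul_one, zero_mul, add_zero, div_one, one_pow] at hκ hϖ
  set κ := fun n : ℕ => √(n : ℝ) * (r n * v / (1 + r n * v))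
  set ϖ := fun n : ℕ => n * (r n * v / (1 + r n * v)) * (r n * v)
  set b := fun n => θ + (1 / 2 : ℝ) • ν n • τ n
  -- The bounds are uniform in the rate: `ν n` and `τ n` enter only through the chord `ν n • τ n`,
  -- of norm at most `2`, and its midpoint `b n`, of norm at most `1`.
  refine isLittleOP_of_meanAbsLE (Z := fun n x => (κ n - ℓ * v) * devForm θ (r n) v (ν n • τ n) (b n) x +
      κ n * meanForm (ν n • τ n) (b n) x +
      (ℓ ^ 2 * v ^ 2 - ϖ n) * (‖ν n • τ n‖ ^ 2 / 2 * (1 - ‖ν n • τ n‖ ^ 2 / 4)))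
    (c := fun n => |κ n - ℓ * v| * (K * (2 * 1)) + |κ n| * (K * (2 * 1) * (√(n : ℝ))⁻¹) +
      |ℓ ^ 2 * v ^ 2 - ϖ n| * (2 ^ 2 / 2 * 1)) ?_ ?_ ?_
  · filter_upwards [eventually_ge_atTop 1] with n hn
    filter_upwards [logLik_ae_eq hn hθ (hτ n hn) (hr n hn) hv] with x hx
    rw [hx]
    simp only [κ, ϖ, b]
    ring
  · filter_upwards [eventually_ge_atTop 1] with n hn
    obtain ⟨hdev, hmean⟩ := hK n hn (r n) (hr n hn) (hR n hn) (ν n • τ n) (b n)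
    have hδ := norm_le_two_of_norm_add_eq_one hθ (hτ n hn)
    have hb2 := norm_add_half_smul_sq hθ (hτ n hn)
    have hb : ‖b n‖ ≤ 1 := by
      refine abs_le_of_sq_le_sq' ?_ zero_le_one |>.2
      simp only [b]
      rw [hb2]
      nlinarith [sq_nonneg ‖ν n • τ n‖]
    have hnn : 0 ≤ 1 - ‖ν n • τ n‖ ^ 2 / 4 := by rw [← hb2]; positivity
    refine ((((hdev.mono ?_).const_mul _).add ((hmean.mono ?_).const_mul _)).add
      ((meanAbsLE_const _).mono ?_))
    · gcongr
    · gcongr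
    · rw [abs_mul, abs_of_nonneg (a := ‖ν n • τ n‖ ^ 2 / 2 * _) (by positivity)]
      gcongr
      linarith [sq_nonneg ‖ν n • τ n‖]
  · have h1 := (hκ.sub_const (ℓ * v)).abs.mul_const (K * (2 * 1))
    have h2 := hκ.abs.mul (tendsto_inv_sqrt_natCast.const_mul (K * (2 * 1)))
    have h3 := (hϖ.const_sub (ℓ ^ 2 * v ^ 2)).abs.mul_const (2 ^ 2 / 2 * 1)
    simpa using (h1.add h2).add h3

/-- Local asymptotic normality at the rate `ν` with `√n r ν = 1`, when this rate tends to zero. -/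
lemma isLittleOP_logLik_sub_of_local {θ : EuclideanSpace ℝ (Fin p)} (hθ : ‖θ‖ = 1) {v : ℝ}
    (hv : 0 < v) {r : ℕ → ℝ} (hr : ∀ n, 1 ≤ n → 0 < r n) {R : ℝ} (hR : ∀ n, 1 ≤ n → r n ≤ R)
    {ρ : ℝ} (hρ0 : 0 ≤ ρ) (hρ : Tendsto r atTop (𝓝 ρ)) {ν : ℕ → ℝ} (hν : Tendsto ν atTop (𝓝 0))
    (hrν : ∀ n : ℕ, 1 ≤ n → √(n : ℝ) * r n * ν n = 1) {τ : ℕ → EuclideanSpace ℝ (Fin p)}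
    (hτ : IsAdmissible θ ν τ) :
    IsLittleOP (fun n => sampleLaw n θ (r n) v) (fun n x => logLik n θ (r n) v (ν n) (τ n) x -
      (v / (1 + ρ * v) * (devForm θ (r n) v (τ n) θ x - ⟪θ, τ n⟫ * devForm θ (r n) v θ θ x) -
        1 / 2 * (v ^ 2 / (1 + ρ * v) * (‖τ n‖ ^ 2 - ⟪θ, τ n⟫ ^ 2)))) := by
  obtain ⟨K, hK0, hK⟩ := exists_meanAbsLE_forms hθ hv R
  obtain ⟨⟨B, hB⟩, hτ⟩ := hτ
  have hB0 : 0 ≤ B := (norm_nonneg _).trans (hB 1 le_rfl)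
  obtain ⟨hκ, hϖ⟩ := tendsto_spike_coefficients (s := ν) (ℓ := 1) hv hρ0 hρ
    (tendsto_const_nhds.congr' (by
      filter_upwards [eventually_ge_atTop 1] with n hn using (hrν n hn).symm))
  rw [one_mul] at hκ
  rw [one_pow, one_mul] at hϖ
  set κ := fun n : ℕ => √(n : ℝ) * (r n * v / (1 + r n * v)) * ν n
  set ϖ := fun n : ℕ => n * (r n * v / (1 + r n * v)) * (r n * v) * ν n ^ 2
  set k := v / (1 + ρ * v)
  set q := v ^ 2 / (1 + ρ * v)
  -- The error is exactly five terms: the linear coefficient, the half-chord in the second argument,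
  -- the sample mean, the component of `τ n` along `θ`, and the quadratic coefficient.
  refine isLittleOP_of_meanAbsLE (Z := fun n x => (κ n - k) * devForm θ (r n) v (τ n) θ x +
      κ n * ν n / 2 * devForm θ (r n) v (τ n) (τ n) x +
      κ n * meanForm (τ n) (θ + (1 / 2 : ℝ) • ν n • τ n) x +
      k * ⟪θ, τ n⟫ * devForm θ (r n) v θ θ x +
      (q - ϖ n) * (1 / 2 * (‖τ n‖ ^ 2 - ⟪θ, τ n⟫ ^ 2)))
    (c := fun n => |κ n - k| * (K * (B * 1)) + |κ n * ν n / 2| * (K * (B * B)) +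
      |κ n| * (K * (B * (1 + 1 / 2 * (|ν n| * B))) * (√(n : ℝ))⁻¹) +
      |k| * (|ν n| * (B ^ 2 / 2)) * (K * (1 * 1)) +
      |q - ϖ n| * (1 / 2 * B ^ 2)) ?_ ?_ ?_
  · filter_upwards [eventually_ge_atTop 1] with n hn
    filter_upwards [logLik_ae_eq hn hθ (hτ n hn) (hr n hn) hv] with x hx
    have hin := inner_of_norm_add_eq_one hθ (hτ n hn)
    rw [hx]
    by_cases hν0 : ν n = 0
    · have := hrν n hn
      rw [hν0] at this
      simp at this
    rw [norm_smul, mul_pow, Real.norm_eq_abs, sq_abs, inner_smul_right] at hin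
    -- Turns the quartic part `ν² ‖τ‖⁴ / 4` of the constant into `⟪θ, τ⟫²`, so the quadratic term is
    -- that of the projection orthogonal to `θ`.
    have hin' : ⟪θ, τ n⟫ = -(ν n * ‖τ n‖ ^ 2 / 2) := by
      apply mul_left_cancel₀ hν0
      rw [hin]
      ring
    have hm : meanForm (ν n • τ n) (θ + (1 / 2 : ℝ) • ν n • τ n) x =
        ν n * meanForm (τ n) (θ + (1 / 2 : ℝ) • ν n • τ n) x := by
      simp only [meanForm, inner_smul_left, conj_trivial]
      ring
    have hd : devForm θ (r n) v (ν n • τ n) (θ + (1 / 2 : ℝ) • ν n • τ n) x =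
        ν n * (devForm θ (r n) v (τ n) θ x + ν n / 2 * devForm θ (r n) v (τ n) (τ n) x) := by
      simp only [devForm, inner_smul_left, conj_trivial, map_add, map_smul, inner_add_right,
        inner_smul_right]
      ring
    rw [hm, hd, hin', norm_smul, mul_pow, Real.norm_eq_abs, sq_abs]
    simp only [κ, ϖ]
    ring
  · filter_upwards [eventually_ge_atTop 1] with n hn
    have hforms := hK n hn (r n) (hr n hn) (hR n hn)
    have hτB := hB n hn
    have hinner : |⟪θ, τ n⟫| ≤ ‖τ n‖ := by
      simpa [hθ] using abs_real_inner_le_norm θ (τ n)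
    have hinner2 : |⟪θ, τ n⟫| ≤ |ν n| * (B ^ 2 / 2) := by
      have hin := inner_of_norm_add_eq_one hθ (hτ n hn)
      rw [norm_smul, mul_pow, inner_smul_right] at hin
      have hν0 : ν n ≠ 0 := fun h => by
        have := hrν n hn
        rw [h] at this
        simp at this
      have h0 : 0 < |ν n| := abs_pos.2 hν0
      have h1 : |ν n| * |⟪θ, τ n⟫| = |ν n| * (|ν n| * (‖τ n‖ ^ 2 / 2)) := by
        rw [← abs_mul, hin, abs_neg, Real.norm_eq_abs, abs_of_nonneg (by positivity)]
        ring
      rw [mul_left_cancel₀ h0.ne' h1]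
      gcongr
    have hsq : 0 ≤ ‖τ n‖ ^ 2 - ⟪θ, τ n⟫ ^ 2 := by
      rw [← sq_abs ⟪θ, τ n⟫, sub_nonneg]
      gcongr
    have hb : ‖θ + (1 / 2 : ℝ) • ν n • τ n‖ ≤ 1 + 1 / 2 * (|ν n| * B) := by
      refine (norm_add_le _ _).trans ?_
      rw [hθ, norm_smul, norm_smul, Real.norm_eq_abs, Real.norm_eq_abs, abs_of_pos (by norm_num)]
      gcongr
    refine (((((hforms _ _).1.mono ?_).const_mul _).add (((hforms _ _).1.mono ?_).const_mul _)).add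
      (((hforms _ _).2.mono ?_).const_mul _)).add (((hforms _ _).1.const_mul _).mono ?_)
      |>.add ((meanAbsLE_const _).mono ?_)
    · rw [hθ]; gcongr
    · gcongr
    · gcongr
    · rw [abs_mul, hθ]; gcongr
    · rw [abs_mul, abs_of_nonneg (a := 1 / 2 * _) (by positivity)]
      gcongr
      calc _ ≤ ‖τ n‖ ^ 2 := sub_le_self _ (sq_nonneg _)
        _ ≤ B ^ 2 := by gcongr
  · have h1 := (hκ.sub_const k).abs.mul_const (K * (B * 1))
    have h2 := ((hκ.mul hν).div_const 2).abs.mul_const (K * (B * B))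
    have h3 := hκ.abs.mul (((((hν.abs.mul_const B).const_mul (1 / 2)).const_add 1).const_mul
      B |>.const_mul K).mul tendsto_inv_sqrt_natCast)
    have h4 := ((hν.abs.mul_const (B ^ 2 / 2)).const_mul |k|).mul_const (K * (1 * 1))
    have h5 := (hϖ.const_sub q).abs.mul_const (1 / 2 * B ^ 2)
    simpa using (((h1.add h2).add h3).add h4).add h5

end Expansion

/-! ### Limit laws of the score and of the weak-spike linear term. -/

section AsymptoticNormality

variable {p : ℕ}

lemma posSemidef_one_sub_outer {θ : EuclideanSpace ℝ (Fin p)} (hθ : ‖θ‖ = 1) :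
    (1 - outer θ).PosSemidef := by
  refine Matrix.PosSemidef.of_dotProduct_mulVec_nonneg ?_ fun x => ?_
  · exact Matrix.isHermitian_one.sub (posSemidef_outer θ).1
  · have h := inner_toEuclideanLin_one_sub_outer θ (WithLp.toLp 2 x) (WithLp.toLp 2 x)
    rw [inner_toEuclideanLin] at h
    simp only [star_trivial]
    rw [h, real_inner_self_eq_norm_sq, ← sq, ← sq_abs ⟪θ, _⟫]
    have := abs_real_inner_le_norm θ (WithLp.toLp 2 x)
    rw [hθ, one_mul] at this
    exact sub_nonneg.2 (pow_le_pow_left₀ (abs_nonneg _) this 2)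

lemma measurable_scaledDev_smul_toEuclideanLin {n : ℕ} (θ b : EuclideanSpace ℝ (Fin p))
    (r v k : ℝ) :
    Measurable fun x : Sample p n =>
      k • toEuclideanLin ((1 - outer θ) * scaledDev θ r v x) b := by
  refine Measurable.const_smul ?_ k
  refine (WithLp.measurable_toLp 2 _).comp (g := WithLp.toLp 2) (f := fun x : Sample p n =>
    (toEuclideanLin ((1 - outer θ) * scaledDev θ r v x) b).ofLp) (measurable_pi_lambda _ fun i => ?_)
  set e := EuclideanSpace.basisFun (Fin p) ℝ i
  have h : (fun x : Sample p n => (toEuclideanLin ((1 - outer θ) * scaledDev θ r v x) b).ofLp i) =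
      devForm θ r v (e - ⟪θ, e⟫ • θ) b := by
    ext x
    rw [← inner_toEuclideanLin_one_sub_outer_mul_scaledDev]
    simp [e, EuclideanSpace.inner_single_left]
  rw [h]
  exact measurable_devForm _ _ _ _ _

/-- Tested against `t`, the score is the covariance form at `a` and `θ`, where `a` is `k` times the
projection of `t` orthogonal to `θ`. The limiting spike map fixes `a` and stretches `θ` by `√(1 + ρ
v)`, so orthogonality persists, and `k² (1 + ρ v) = v² / (1 + ρ v)` gives the covariance. -/
lemma tendstoInDistribution_score {θ : EuclideanSpace ℝ (Fin p)} (hθ : ‖θ‖ = 1) {v : ℝ}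
    (hv : 0 < v) {r : ℕ → ℝ} (hr : ∀ n, 1 ≤ n → 0 < r n) {ρ : ℝ} (hρ0 : 0 ≤ ρ)
    (hρ : Tendsto r atTop (𝓝 ρ)) :
    TendstoInDistribution (fun n (x : Sample p n) =>
        (v / (1 + ρ * v)) • toEuclideanLin ((1 - outer θ) * scaledDev θ (r n) v x) θ) atTop id
      (fun n => sampleLaw n θ (r n) v)
      (multivariateGaussian 0 ((v ^ 2 / (1 + ρ * v)) • (1 - outer θ))) := by
  have hpos : 0 < 1 + ρ * v := by positivity
  have hθθ : ⟪θ, θ⟫ = (1 : ℝ) := by rw [real_inner_self_eq_norm_sq, hθ]; norm_num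
  refine tendstoInDistribution_of_tendsto_charFun
    (fun n => measurable_scaledDev_smul_toEuclideanLin θ θ (r n) v _) fun t => ?_
  set k := v / (1 + ρ * v)
  set a := k • (t - ⟪θ, t⟫ • θ)
  have hθa : ⟪θ, a⟫ = 0 := by
    simp only [a, inner_smul_right, inner_sub_right, hθθ]
    ring
  have hspike : spikeMap θ √(1 + ρ * v) a = a := by rw [spikeMap_apply, hθa]; simp
  have hnorm_a : ‖a‖ ^ 2 = k ^ 2 * (⟪t, t⟫ - ⟪θ, t⟫ * ⟪θ, t⟫) := by
    rw [← real_inner_self_eq_norm_sq]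
    simp only [a, inner_smul_left, inner_smul_right, inner_sub_right, inner_sub_left, hθθ,
      real_inner_comm t θ, conj_trivial]
    ring
  have hnorm_θ : ‖spikeMap θ √(1 + ρ * v) θ‖ ^ 2 = 1 + ρ * v := by
    rw [← real_inner_self_eq_norm_sq, inner_spikeMap_spikeMap hθ, hθθ, Real.sq_sqrt hpos.le]
    ring
  have h := tendsto_integral_cexp_devForm hθ hv hr hρ (a := fun _ => a) (b := fun _ => θ)
    tendsto_const_nhds tendsto_const_nhds (by
      rw [inner_spikeMap_spikeMap hθ, hθa, real_inner_comm, hθa]; ring)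
  rw [hspike, hnorm_a, hnorm_θ] at h
  have hchar : charFun (multivariateGaussian 0 ((v ^ 2 / (1 + ρ * v)) • (1 - outer θ))) t =
      Complex.exp (-(k ^ 2 * (⟪t, t⟫ - ⟪θ, t⟫ * ⟪θ, t⟫) * (1 + ρ * v)) / 2 : ℝ) := by
    rw [charFun_multivariateGaussian ((posSemidef_one_sub_outer hθ).smul (by positivity)),
      Matrix.smul_mulVec, dotProduct_smul, ← inner_toEuclideanLin,
      inner_toEuclideanLin_one_sub_outer]
    congr 1
    have hkq : k ^ 2 * (1 + ρ * v) = v ^ 2 / (1 + ρ * v) := by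
      simp only [k]
      field_simp
    rw [mul_right_comm, hkq, inner_zero_right]
    push_cast
    simp
    ring
  rw [hchar]
  refine h.congr fun n => integral_congr_ae (ae_of_all _ fun x => ?_)
  simp only []
  rw [inner_smul_left, real_inner_comm, inner_toEuclideanLin_one_sub_outer_mul_scaledDev]
  simp only [a, devForm, inner_smul_left, conj_trivial]

/-- The spike map tends to the identity, so the orthogonality of chord and midpoint is all that is
needed; the variance is the product of their squared norms. -/
lemma tendstoInDistribution_devForm_of_weak_spike {θ : EuclideanSpace ℝ (Fin p)} (hθ : ‖θ‖ = 1)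
    {v : ℝ} (hv : 0 < v) {r : ℕ → ℝ} (hr : ∀ n, 1 ≤ n → 0 < r n) (hr0 : Tendsto r atTop (𝓝 0))
    {τ : ℕ → EuclideanSpace ℝ (Fin p)} (hτ : ∀ n, 1 ≤ n → ‖θ + τ n‖ = 1)
    {τ' : EuclideanSpace ℝ (Fin p)} (hlim : Tendsto τ atTop (𝓝 τ')) :
    ∃ w : NNReal, (w : ℝ) = ‖τ'‖ ^ 2 - 1 / 4 * ‖τ'‖ ^ 4 ∧
      TendstoInDistribution (fun n => devForm θ (r n) v (τ n) (θ + (1 / 2 : ℝ) • τ n)) atTop id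
        (fun n => sampleLaw n θ (r n) v) (gaussianReal 0 w) := by
  have hτ' : ‖θ + τ'‖ = 1 := by
    refine tendsto_nhds_unique (hlim.const_add θ).norm (tendsto_const_nhds.congr' ?_)
    filter_upwards [eventually_ge_atTop 1] with n hn using (hτ n hn).symm
  have hb2 := norm_add_half_smul_sq hθ hτ'
  have hw : ‖τ'‖ ^ 2 - 1 / 4 * ‖τ'‖ ^ 4 = ‖τ'‖ ^ 2 * ‖θ + (1 / 2 : ℝ) • τ'‖ ^ 2 := by
    rw [hb2]; ring
  obtain ⟨w, hw'⟩ : ∃ w : NNReal, (w : ℝ) = ‖τ'‖ ^ 2 - 1 / 4 * ‖τ'‖ ^ 4 :=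
    ⟨⟨_, by rw [hw]; positivity⟩, rfl⟩
  refine ⟨w, hw', ?_⟩
  refine tendstoInDistribution_of_tendsto_charFun (fun n => measurable_devForm _ _ _ _ _)
    fun t => ?_
  have hspike : ∀ c, spikeMap θ √(1 + 0 * v) c = c := fun c => by simp [spikeMap_apply]
  have h := tendsto_integral_cexp_devForm hθ hv hr hr0 (hlim.const_smul t)
    ((hlim.const_smul (1 / 2 : ℝ)).const_add θ) (by
      rw [hspike, hspike, inner_smul_left, inner_add_half_smul hθ hτ', mul_zero])
  rw [hspike, hspike, norm_smul, mul_pow, mul_assoc, ← hw, ← hw', Real.norm_eq_abs, sq_abs] at h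
  rw [charFun_gaussianReal]
  convert! h using 2
  · refine integral_congr_ae (ae_of_all _ fun x => ?_)
    simp [devForm, inner_smul_left]
  · congr 1
    simp
    ring

end AsymptoticNormality

end SpikedGaussian

/-! ### The four regimes. -/

theorem theorem4p1 {p : ℕ} (θ : EuclideanSpace ℝ (Fin p)) (hθ : ‖θ‖ = 1)
    (v : ℝ) (hv : 0 < v) (r : ℕ → ℝ) (hr_pos : ∀ n, 1 ≤ n → 0 < r n)
    (hr_bdd : ∃ C : ℝ, ∀ n, 1 ≤ n → r n ≤ C) :
    -- the regime `r_n ≡ 1`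
    ((∀ n, 1 ≤ n → r n = 1) →
      ∀ (ν : ℕ → ℝ) (Δ : ∀ n, Sample p n → EuclideanSpace ℝ (Fin p))
        (Γ : Matrix (Fin p) (Fin p) ℝ),
        (∀ n, ν n = 1 / √(n : ℝ)) →
        (∀ n x, Δ n x =
          (v / (1 + v)) • toEuclideanLin ((1 - outer θ) * scaledDev θ (r n) v x) θ) →
        Γ = (v ^ 2 / (1 + v)) • (1 - outer θ) →
        (∀ τ : ℕ → EuclideanSpace ℝ (Fin p), IsAdmissible θ ν τ →
          IsLittleOP (fun n => sampleLaw n θ (r n) v) (fun n x =>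
            logLik n θ (r n) v (ν n) (τ n) x -
              (⟪τ n, Δ n x⟫ - 1 / 2 * ⟪τ n, toEuclideanLin Γ (τ n)⟫))) ∧
        TendstoInDistribution Δ atTop id (fun n => sampleLaw n θ (r n) v)
          (multivariateGaussian 0 Γ)) ∧
    -- the regime `r_n = o(1)`, `√n r_n → ∞`
    (Tendsto r atTop (𝓝 0) → Tendsto (fun n : ℕ => √(n : ℝ) * r n) atTop atTop →
      ∀ (ν : ℕ → ℝ) (Δ : ∀ n, Sample p n → EuclideanSpace ℝ (Fin p))
        (Γ : Matrix (Fin p) (Fin p) ℝ),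
        (∀ n, ν n = 1 / (√(n : ℝ) * r n)) →
        (∀ n x, Δ n x = v • toEuclideanLin ((1 - outer θ) * scaledDev θ (r n) v x) θ) →
        Γ = v ^ 2 • (1 - outer θ) →
        (∀ τ : ℕ → EuclideanSpace ℝ (Fin p), IsAdmissible θ ν τ →
          IsLittleOP (fun n => sampleLaw n θ (r n) v) (fun n x =>
            logLik n θ (r n) v (ν n) (τ n) x -
              (⟪τ n, Δ n x⟫ - 1 / 2 * ⟪τ n, toEuclideanLin Γ (τ n)⟫))) ∧
        TendstoInDistribution Δ atTop id (fun n => sampleLaw n θ (r n) v)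
          (multivariateGaussian 0 Γ)) ∧
    -- the regime `r_n = 1 / √n`
    ((∀ n, 1 ≤ n → r n = 1 / √(n : ℝ)) →
      ∀ τ : ℕ → EuclideanSpace ℝ (Fin p), IsAdmissible θ (fun _ => 1) τ →
        IsLittleOP (fun n => sampleLaw n θ (r n) v) (fun n x =>
          logLik n θ (r n) v 1 (τ n) x -
            (⟪τ n, toEuclideanLin (v • scaledDev θ (r n) v x) (θ + (1 / 2 : ℝ) • τ n)⟫
              - v ^ 2 / 2 * ‖τ n‖ ^ 2 + v ^ 2 / 8 * ‖τ n‖ ^ 4)) ∧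
        ∀ τ' : EuclideanSpace ℝ (Fin p), Tendsto τ atTop (𝓝 τ') →
          ∃ w : NNReal, (w : ℝ) = ‖τ'‖ ^ 2 - 1 / 4 * ‖τ'‖ ^ 4 ∧
            TendstoInDistribution
              (fun n (x : Sample p n) =>
                ⟪τ n, toEuclideanLin (scaledDev θ (r n) v x) (θ + (1 / 2 : ℝ) • τ n)⟫)
              atTop id (fun n => sampleLaw n θ (r n) v) (gaussianReal 0 w)) ∧
    -- the regime `r_n = o(1 / √n)`, for any positive `ν_n`, in particular `ν_n ≡ 1`
    (r =o[atTop] (fun n : ℕ => 1 / √(n : ℝ)) →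
      ∀ ν : ℕ → ℝ, (∀ n, 1 ≤ n → 0 < ν n) →
        ∀ τ : ℕ → EuclideanSpace ℝ (Fin p), IsAdmissible θ ν τ →
          IsLittleOP (fun n => sampleLaw n θ (r n) v) (fun n x =>
            logLik n θ (r n) v (ν n) (τ n) x)) := by
  obtain ⟨R, hR⟩ := hr_bdd
  -- The first two regimes share the normalisation `√n r ν = 1` and differ only in the limit of the
  -- spikes: `ρ = 1` and `ρ = 0`.
  have hlocal : ∀ ρ : ℝ, 0 ≤ ρ → Tendsto r atTop (𝓝 ρ) → ∀ ν : ℕ → ℝ, Tendsto ν atTop (𝓝 0) →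
      (∀ n : ℕ, 1 ≤ n → √(n : ℝ) * r n * ν n = 1) →
      ∀ (Δ : ∀ n, Sample p n → EuclideanSpace ℝ (Fin p)) (Γ : Matrix (Fin p) (Fin p) ℝ),
      (∀ n x, Δ n x =
        (v / (1 + ρ * v)) • toEuclideanLin ((1 - outer θ) * scaledDev θ (r n) v x) θ) →
      Γ = (v ^ 2 / (1 + ρ * v)) • (1 - outer θ) →
      (∀ τ : ℕ → EuclideanSpace ℝ (Fin p), IsAdmissible θ ν τ →
        IsLittleOP (fun n => sampleLaw n θ (r n) v) (fun n x =>
          logLik n θ (r n) v (ν n) (τ n) x -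
            (⟪τ n, Δ n x⟫ - 1 / 2 * ⟪τ n, toEuclideanLin Γ (τ n)⟫))) ∧
      TendstoInDistribution Δ atTop id (fun n => sampleLaw n θ (r n) v)
        (multivariateGaussian 0 Γ) := by
    intro ρ hρ0 hρ ν hν hrν Δ Γ hΔ hΓ
    obtain rfl : Δ = fun n (x : Sample p n) =>
        (v / (1 + ρ * v)) • toEuclideanLin ((1 - outer θ) * scaledDev θ (r n) v x) θ := by
      ext1 n
      ext1 x
      exact hΔ n x
    subst hΓ
    refine ⟨fun τ hτ => ?_, tendstoInDistribution_score hθ hv hr_pos hρ0 hρ⟩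
    have h := isLittleOP_logLik_sub_of_local hθ hv hr_pos hR hρ0 hρ hν hrν hτ
    convert! h using 5 with n x
    · rw [inner_smul_right, inner_toEuclideanLin_one_sub_outer_mul_scaledDev]
      simp only [devForm, inner_sub_left, inner_smul_left, conj_trivial]
    · rw [map_smul, LinearMap.smul_apply, inner_smul_right, inner_toEuclideanLin_one_sub_outer,
        real_inner_self_eq_norm_sq]
      ring
  have hsqrt : ∀ n : ℕ, 1 ≤ n → 0 < √(n : ℝ) := fun n hn =>
    Real.sqrt_pos.2 (by exact_mod_cast hn)
  refine ⟨fun hr ν Δ Γ hν hΔ hΓ => ?_, fun hr hr' ν Δ Γ hν hΔ hΓ => ?_, fun hr τ hτ => ?_,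
    fun hr ν _ τ hτ => ?_⟩
  · have hρ : Tendsto r atTop (𝓝 1) := tendsto_const_nhds.congr' (by
      filter_upwards [eventually_ge_atTop 1] with n hn using (hr n hn).symm)
    refine hlocal 1 zero_le_one hρ ν ?_ (fun n hn => ?_) Δ Γ (by simpa using hΔ) (by simpa using hΓ)
    · simpa [funext hν] using tendsto_inv_sqrt_natCast
    · rw [hr n hn, hν, mul_one, mul_one_div_cancel (hsqrt n hn).ne']
  · refine hlocal 0 le_rfl hr ν ?_ (fun n hn => ?_) Δ Γ (by simpa using hΔ) (by simpa using hΓ)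
    · exact (tendsto_inv_atTop_zero.comp hr').congr fun n => by rw [hν, one_div, Function.comp_apply]
    · rw [hν, mul_one_div_cancel (mul_pos (hsqrt n hn) (hr_pos n hn)).ne']
  · have hone : Tendsto (fun n : ℕ => √(n : ℝ) * r n) atTop (𝓝 1) := tendsto_const_nhds.congr' (by
      filter_upwards [eventually_ge_atTop 1] with n hn
      rw [hr n hn, mul_one_div_cancel (hsqrt n hn).ne'])
    have hr0 : Tendsto r atTop (𝓝 0) := tendsto_inv_sqrt_natCast.congr' (by
      filter_upwards [eventually_ge_atTop 1] with n hn
      rw [hr n hn, one_div])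
    have hτ1 : ∀ n, 1 ≤ n → ‖θ + τ n‖ = 1 := fun n hn => by simpa using hτ.2 n hn
    refine ⟨?_, fun τ' hlim => tendstoInDistribution_devForm_of_weak_spike hθ hv hr_pos hr0 hτ1 hlim⟩
    have h := isLittleOP_logLik_sub_of_weak_spike hθ hv hr_pos hR hone hτ.2
    convert! h using 3 with n x
    simp only [devForm, map_smul, LinearMap.smul_apply, inner_smul_right, one_smul]
    ring
  -- With `ℓ = 0` both terms of the weak-spike expansion vanish, leaving the log-likelihood ratio
  -- itself.
  · have hzero : Tendsto (fun n : ℕ => √(n : ℝ) * r n) atTop (𝓝 0) := by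
      refine hr.tendsto_div_nhds_zero.congr fun n => ?_
      rw [div_div_eq_mul_div, div_one, mul_comm]
    have h := isLittleOP_logLik_sub_of_weak_spike hθ hv hr_pos hR hzero hτ.2
    simpa using h
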